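/- **Setting.** There are $k$ agents with probability distributions $\mathcal D_1,\dots,\mathcal D_k$ on an instance space $\mathcal X$ and costs per sample $c_1,\dots,c_k>0$. Let $\mathcal H$ be a class of functions $\mathcal X\to\mathcal Y$ and write $\mathrm{DIS}(h_1,h_2)=\{x: h_1(x)\ne h_2(x)\}$ (assumed measurable for $h_1,h_2\in\mathcal H$). For $\mathbf m\in\mathbb N^k$, agent $i$ draws $m_i$ points from $\mathcal D_i$, all draws being independent; the points are labelled by a target $h^\star\in\mathcal H$ and pooled into a data set $S$. Let $\mathrm{ERM}(S)$ be the set of $h\in\mathcal H$ with minimal empirical error on $S$. Agent $i$'s *$(\varepsilon,\delta)$-requirement* is that for every $h^\star\in\mathcal H$, with probability at least $1-\delta$, $\sup_{h\in\mathrm{ERM}(S)}\mathcal D_i(\mathrm{DIS}(h,h^\star))\le\varepsilon$. Call $\mathbf m\in\mathbb N^k$ *feasible* if every agent's requirement is met. Let $\mathrm{OPT}$ be the minimum of $\mathbf c^\top\mathbf m=\sum_i c_im_i$ over feasible $\mathbf m$. For a finite class $\mathcal G$ and $\eta\in(0,1)$, $\mathrm{LP}(\mathcal G,\varepsilon,\eta)$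 is the problem of minimizing $\mathbf c^\top\mathbf m$ over $\mathbf m\in\mathbb R_{\ge0}^k$ subject to $$\sum_{i=1}^k m_i\log\bigl(1-\mathcal D_i(\mathrm{DIS}(h_1,h_2))\bigr)\le\log\frac{\eta}{|\mathcal G|}\qquad\text{for all }(h_1,h_2)\in\mathcal G^2\text{ with }\mathcal D_i(\mathrm{DIS}(h_1,h_2))>\varepsilon\text{ for some }i,$$ where $\log 0=-\infty$ and $0\cdot(-\infty)=0$. $\mathrm{ILP}(\mathcal G,\varepsilon,\eta)$ is the same problem over $\mathbf m\in\mathbb N^k$. Logarithms are natural, and $\lceil\mathbf m\rceil$ denotes coordinatewise rounding up. **Theorem (Approximation via Linear Programming).** *(1) Finite classes.* Let $\mathcal H$ be finite, $\varepsilon>0$, $0<\delta<1$ and $r=\frac{\log(1/\delta)+\log|\mathcal H|}{\log(1/\delta)}$. If $\mathbf m$ is an optimal solution of $\mathrm{LP}(\mathcal H,\varepsilon,\delta)$, then $\lceil\mathbf m\rceil$ is feasible, and $$\mathbf c^\top\mathbf m\le r\cdot\mathrm{OPT},\qquad \mathbf c^\top\lceil\mathbf m\rceil\le r\cdot\mathrm{OPT}+\sum_i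 c_i .$$ An optimal solution exists whenever no $\mathcal D_i(\mathrm{DIS}(h_1,h_2))$ occurring in the constraints equals $1$. An optimal solution of $\mathrm{ILP}(\mathcal H,\varepsilon,\delta)$ always exists, and every such solution is feasible and costs at most $\lceil r\rceil\cdot\mathrm{OPT}$. *(2) Infinite classes.* Let $\mathcal Y=\{0,1\}$ and let $\mathcal H$ be infinite of finite VC dimension $d$. Let $k\ge1$, $\varepsilon,\delta\in(0,1)$, $c_{\min}=\min_ic_i$, $c_{\max}=\max_ic_i$, and suppose that $\frac{c_{\max}kd}{c_{\min}\varepsilon\delta}\ge2$. Assume the usual measurability proviso: $\mathcal H$ carries a $\sigma$-algebra for which $(x,h)\mapsto h(x)$ is measurable and for which, for every $n$, the projection to $\mathcal X^n$ of each measurable subset of $\mathcal X^n\times\mathcal H$ is universally measurable (this holds, for instance, for countable classes of measurable functions). For a constant $a>0$ put $$\gamma=a\cdot\frac{c_{\min}\varepsilon\delta}{c_{\max}k(d+\log(1/\delta))}.$$ A $\gamma$-cover of $\mathcal H$ is a set $\bar{\mathcal H}\subseteq\mathcal H$ such that every $h\in\mathcal H$ has an $\bar h\in\bar{\mathcal H}$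 with $\max_i\mathcal D_i(\mathrm{DIS}(h,\bar h))\le\gamma$. For finite $\bar{\mathcal H}$ put $$\delta''=\frac{\delta}{4|\bar{\mathcal H}|},\qquad \delta'=\frac{\delta}{8(d+\log(2|\bar{\mathcal H}|/\delta))},\qquad s=d+\log(1/\delta''),\qquad F=\frac{d^2\log^2\bigl(c_{\max}kd/(c_{\min}\varepsilon\delta)\bigr)}{\log(1/\delta)} .$$ For every $a>0$ there are constants $A\in\mathbb N$ and $C$, depending only on $a$, such that the following holds in every such situation. Every finite $\mathcal H_0\subseteq\mathcal H$ with $|\mathcal H_0|\le(41k/\gamma)^d$ is contained in a finite $\gamma$-cover $\bar{\mathcal H}$ of $\mathcal H$ with $|\bar{\mathcal H}|\le(Ak/\gamma)^{Ad}$ such that: - $\mathrm{ILP}(\bar{\mathcal H},\varepsilon,\delta')$ has an optimal solution, and for each optimal solution $\mathbf m$ the vector $\lceil s\,\mathbf m\rceil$ is feasible (for all of $\mathcal H$) and costs at most $C\,F\cdot\mathrm{OPT}$; - for each optimal solution $\mathbf m$ of $\mathrm{LP}(\bar{\mathcal H},\varepsilon,\delta')$ the vector $\lceil s\lceil\mathbf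 m\rceil\rceil$ is feasible (for all of $\mathcal H$), and $s\,\mathbf c^\top\mathbf m\le C\,F\cdot\mathrm{OPT}$ and $\mathbf c^\top\lceil s\lceil\mathbf m\rceil\rceil\le C\,F\cdot\mathrm{OPT}+2s\sum_ic_i$. -/

import Mathlib

open MeasureTheory

noncomputable section

namespace CollabPAC

/-! ### Learning model -/

/-- The disagreement region of two hypotheses. -/
def dis {X Y : Type*} (h₁ h₂ : X → Y) : Set X := {x | h₁ x ≠ h₂ x}

/-- Empirical error of `h` on a finite labelled data set `S` (a family indexed by a finite type):
the fraction of misclassified examples, and `0` on the empty data set. -/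
def empErr {X Y J : Type*} [Fintype J] (S : J → X × Y) (h : X → Y) : ℝ :=
  ({j | h (S j).1 ≠ (S j).2}.ncard : ℝ) / (Fintype.card J : ℝ)

/-- The set of empirical risk minimizers over the class `H`. -/
def ERM {X Y J : Type*} [Fintype J] (H : Set (X → Y)) (S : J → X × Y) : Set (X → Y) :=
  {h | h ∈ H ∧ ∀ h' ∈ H, empErr S h ≤ empErr S h'}

/-- Worst generalization error, under the marginal `D` and the target `hstar`, of an empirical
risk minimizer for the data set `S`. -/
def errERM {X Y J : Type*} [MeasurableSpace X] [Fintype J] (H : Set (X → Y)) (D : Measure X)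
    (hstar : X → Y) (S : J → X × Y) : ENNReal :=
  ⨆ h ∈ ERM H S, D (dis h hstar)

/-- Unlabelled samples: agent `i` contributes the points `U i 0, …, U i (m i - 1)`. -/
abbrev Sample (X : Type*) {k : ℕ} (m : Fin k → ℕ) : Type _ := (i : Fin k) → Fin (m i) → X

/-- The law of the unlabelled samples: agent `i` draws `m i` points from `D i`, all draws being
independent. -/
def sampleLaw {X : Type*} [MeasurableSpace X] {k : ℕ} (D : Fin k → Measure X) (m : Fin k → ℕ) :
    Measure (Sample X m) :=
  Measure.pi fun i => Measure.pi fun _ : Fin (m i) => D i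

/-- The pooled data set, labelled by the target `hstar`. -/
def pooled {X Y : Type*} {k : ℕ} {m : Fin k → ℕ} (hstar : X → Y) (U : Sample X m) :
    (Σ i : Fin k, Fin (m i)) → X × Y :=
  fun j => (U j.1 j.2, hstar (U j.1 j.2))

/-- The `(ε, δ)`-requirement of agent `i` under the contribution vector `m`: for every target, with
probability at least `1 - δ`, every empirical risk minimizer on the pooled data has error at most
`ε` under `D i`. -/
def Requirement {X Y : Type*} [MeasurableSpace X] {k : ℕ} (H : Set (X → Y))
    (D : Fin k → Measure X) (ε δ : ℝ) (i : Fin k) (m : Fin k → ℕ) : Prop :=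
  ∀ hstar ∈ H, ENNReal.ofReal (1 - δ) ≤
    sampleLaw D m {U | errERM H (D i) hstar (pooled hstar U) ≤ ENNReal.ofReal ε}

/-- Feasibility for the social cost problem: the requirements of all agents are met. -/
def PACFeasible {X Y : Type*} [MeasurableSpace X] {k : ℕ} (H : Set (X → Y))
    (D : Fin k → Measure X) (ε δ : ℝ) (m : Fin k → ℕ) : Prop :=
  ∀ i, Requirement H D ε δ i m

/-- Total cost of a (possibly fractional) contribution vector. -/
def cost {k : ℕ} (c : Fin k → ℝ) (m : Fin k → ℝ) : ℝ := ∑ i, c i * m i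

/-! ### The linear program -/

/-- Feasibility for the log-linear program over a finite class `H`: for each ordered pair of
hypotheses whose disagreement mass exceeds `ε` for some agent,
`∑ i, m i * log (1 - D i (dis h₁ h₂)) ≤ log (δ / |H|)`.
Logarithms take values in the extended reals, so `log 0 = -∞` (and `0 * (-∞) = 0`). -/
def LPFeasible {X Y : Type*} [MeasurableSpace X] {k : ℕ} (H : Set (X → Y))
    (D : Fin k → Measure X) (ε δ : ℝ) (m : Fin k → ℝ) : Prop :=
  (∀ i, 0 ≤ m i) ∧
    ∀ h₁ ∈ H, ∀ h₂ ∈ H, (∃ i, ENNReal.ofReal ε < D i (dis h₁ h₂)) →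
      ∑ i, ((m i : ℝ) : EReal) * ENNReal.log (1 - D i (dis h₁ h₂)) ≤
        ENNReal.log (ENNReal.ofReal (δ / (H.ncard : ℝ)))

/-- Optimal solutions of the linear program over nonnegative real vectors. -/
def IsLPSolution {X Y : Type*} [MeasurableSpace X] {k : ℕ} (H : Set (X → Y))
    (D : Fin k → Measure X) (c : Fin k → ℝ) (ε δ : ℝ) (m : Fin k → ℝ) : Prop :=
  LPFeasible H D ε δ m ∧ ∀ m' : Fin k → ℝ, LPFeasible H D ε δ m' → cost c m ≤ cost c m'

/-- Optimal solutions of the same program over vectors of natural numbers. -/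
def IsIntLPSolution {X Y : Type*} [MeasurableSpace X] {k : ℕ} (H : Set (X → Y))
    (D : Fin k → Measure X) (c : Fin k → ℝ) (ε δ : ℝ) (m : Fin k → ℕ) : Prop :=
  LPFeasible H D ε δ (fun i => (m i : ℝ)) ∧
    ∀ m' : Fin k → ℕ, LPFeasible H D ε δ (fun i => (m' i : ℝ)) →
      cost c (fun i => (m i : ℝ)) ≤ cost c (fun i => (m' i : ℝ))

/-- Rounding up to integer counts. -/
def roundUp {k : ℕ} (m : Fin k → ℝ) : Fin k → ℕ := fun i => ⌈m i⌉₊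

/-! ### VC dimension, covers, measurability of a class -/

/-- `H` shatters `s`: every labelling of `s` is realized in `H`. -/
def Shatters {X : Type*} (H : Set (X → Bool)) (s : Finset X) : Prop :=
  ∀ b : X → Bool, ∃ h ∈ H, ∀ x ∈ s, h x = b x

/-- The VC dimension. -/
def vcDim {X : Type*} (H : Set (X → Bool)) : ℕ∞ :=
  ⨆ (s : Finset X) (_ : Shatters H s), (s.card : ℕ∞)

/-- `Hbar ⊆ H` is a `γ`-cover of `H` under the distributions `D`. -/
def IsCover {X Y : Type*} [MeasurableSpace X] {k : ℕ} (H : Set (X → Y)) (D : Fin k → Measure X)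
    (γ : ℝ) (Hbar : Set (X → Y)) : Prop :=
  Hbar ⊆ H ∧ ∀ h ∈ H, ∃ h' ∈ Hbar, ∀ i, D i (dis h h') ≤ ENNReal.ofReal γ

/-- The usual measurability proviso for an infinite class: it carries a σ-algebra for which
evaluation is jointly measurable and for which projections to `X ^ n` of measurable sets are
universally measurable. -/
def Admissible {X : Type*} [MeasurableSpace X] (H : Set (X → Bool)) : Prop :=
  ∃ _σ : MeasurableSpace H,
    Measurable (fun p : X × H => (p.2 : X → Bool) p.1) ∧
    ∀ (n : ℕ) (E : Set ((Fin n → X) × H)), MeasurableSet E →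
      ∀ μ : Measure (Fin n → X), IsProbabilityMeasure μ → NullMeasurableSet (Prod.fst '' E) μ

/-! ### Parameters for infinite classes -/

def cMin {k : ℕ} (c : Fin k → ℝ) : ℝ := ⨅ i, c i

def cMax {k : ℕ} (c : Fin k → ℝ) : ℝ := ⨆ i, c i

/-- The cover radius, with the constant `a` of the order-of-magnitude prescription. -/
def radius {k : ℕ} (a : ℝ) (c : Fin k → ℝ) (d : ℕ) (ε δ : ℝ) : ℝ :=
  a * (cMin c * ε * δ / (cMax c * (k : ℝ) * ((d : ℝ) + Real.log (1 / δ))))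

/-- `δ'` for a cover with `N` elements. -/
def delta₁ (d N : ℕ) (δ : ℝ) : ℝ := δ / (8 * ((d : ℝ) + Real.log (2 * (N : ℝ) / δ)))

/-- `δ''` for a cover with `N` elements. -/
def delta₂ (N : ℕ) (δ : ℝ) : ℝ := δ / (4 * (N : ℝ))

/-- The scaling factor `d + log (1 / δ'')`. -/
def scale (d N : ℕ) (δ : ℝ) : ℝ := (d : ℝ) + Real.log (1 / delta₂ N δ)

/-- The argument `c_max k d / (c_min ε δ)` of the logarithm. -/
def logArg {k : ℕ} (c : Fin k → ℝ) (d : ℕ) (ε δ : ℝ) : ℝ :=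
  cMax c * (k : ℝ) * (d : ℝ) / (cMin c * ε * δ)

/-- The approximation factor for finite classes. -/
def finiteFactor (N : ℕ) (δ : ℝ) : ℝ :=
  (Real.log (1 / δ) + Real.log (N : ℝ)) / Real.log (1 / δ)

/-- The approximation factor for infinite classes, up to a constant. -/
def infiniteFactor {k : ℕ} (c : Fin k → ℝ) (d : ℕ) (ε δ : ℝ) : ℝ :=
  (d : ℝ) ^ 2 * Real.log (logArg c d ε δ) ^ 2 / Real.log (1 / δ)

end CollabPAC

end

/-!
**Finite classes.** Labels come from a member of the class, so the empirical risk minimizers are the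
hypotheses consistent with the sample, and a sample of shape `m` fails to distinguish `h₁` from `h₂`
with probability `∏ i, (1 - D i (dis h₁ h₂)) ^ m i`. The program asks that this be at most `η / |H|`
for all far apart pairs (`lpFeasible_iff`). A union bound turns its solutions into feasible
contribution vectors (`pacFeasible_of_lpFeasible`). Conversely a feasible vector distinguishes every
far apart pair with probability at least `1 - δ` (`PACFeasible.prod_le`), so its multiple by `r`
solves the program as soon as `δ ^ r ≤ η / |H|` (`PACFeasible.lpFeasible_smul`). This compares the
costs.

**Infinite classes.** The comparison with a feasible vector is the same. What has to be shown is
that a solution of the program for the cover, repeated `s` times, serves the whole class. Let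
`Λ = a k / γ` (`complexity`), which bounds all parameters and is at most the third power of
`logArg`. The cover may be chosen freely up to size `Λ ^ O(d)`, and three choices are made
(`exists_padded_cover`): it is a cover of radius `Λ ^ (-p)`; every far apart pair of the class is
approximated by a far apart pair of the cover; and it is padded to about `Λ ^ (40 p d)` elements, so
that `s` is at least `40 p d log Λ`. By optimality a solution has at most `Λ ^ p / 32` samples
(`sum_roundUp_optimal_le`), so replacing a far apart pair by a close one in the cover changes the
probability of not distinguishing it by at most `1 / 8`, and one sample of shape `m` distinguishes
any far apart pair of the class with probability at least `3 / 4`.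

Such samples are then treated as single examples (`pacFeasible_of_blocks`). For `2 q` independent
ones, symmetrization with a ghost sample (`pi_exists_avoid_le_ghostEvent`, `ghostEvent_mul_le`)
bounds the probability that some far hypothesis is consistent with all of them by `2 G / 2 ^ q`,
where `G` is the number of labelings of all points involved. This number is polynomial in `Λ` to the
power `d` by the Sauer–Shelah lemma (`ncard_labelings_le`), and is beaten by `2 ^ q` because of the
padding (`labelings_le_two_pow`). Beyond the measurability of the single hypotheses, the
measurability proviso is needed only to average over the exchanges of the two samples.
-/

namespace CollabPAC

/-! ### Samples and empirical risk minimizers -/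

section Samples

variable {X Y : Type*} {k : ℕ}

theorem dis_comm (h₁ h₂ : X → Y) : dis h₁ h₂ = dis h₂ h₁ := by
  ext x; simp [dis, ne_comm]

theorem dis_subset_union (h₁ h₂ h₃ : X → Y) : dis h₁ h₃ ⊆ dis h₁ h₂ ∪ dis h₂ h₃ := by
  intro x hx
  simp only [dis, Set.mem_union, Set.mem_ofPred_eq] at *
  by_contra! h
  exact hx (h.1.trans h.2)

theorem empErr_nonneg {J : Type*} [Fintype J] (S : J → X × Y) (h : X → Y) : 0 ≤ empErr S h := by
  unfold empErr; positivity

theorem empErr_eq_zero_iff {J : Type*} [Fintype J] (S : J → X × Y) (h : X → Y) :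
    empErr S h = 0 ↔ ∀ j, h (S j).1 = (S j).2 := by
  unfold empErr
  rw [div_eq_zero_iff]
  constructor
  · rintro (h0 | h0) j
    · rw [Nat.cast_eq_zero, Set.ncard_eq_zero] at h0
      by_contra hj
      exact Set.notMem_empty j (h0 ▸ hj)
    · rw [Nat.cast_eq_zero, Fintype.card_eq_zero_iff] at h0
      exact h0.elim j
  · intro hj
    left
    rw [Nat.cast_eq_zero, Set.ncard_eq_zero, Set.eq_empty_iff_forall_notMem]
    exact fun j h => h (hj j)

/-- The labels come from a member of the class, so the empirical risk minimizers are exactly the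
hypotheses consistent with every example. -/
theorem mem_ERM_pooled {H : Set (X → Y)} {m : Fin k → ℕ} {hstar : X → Y} (hs : hstar ∈ H)
    (U : Sample X m) (h : X → Y) :
    h ∈ ERM H (pooled hstar U) ↔ h ∈ H ∧ ∀ i j, U i j ∉ dis h hstar := by
  have h0 : empErr (pooled hstar U) hstar = 0 := (empErr_eq_zero_iff _ _).2 fun j => rfl
  have key : empErr (pooled hstar U) h = 0 ↔ ∀ i j, U i j ∉ dis h hstar := by
    rw [empErr_eq_zero_iff]
    simp [pooled, dis, Sigma.forall]
  rw [← key]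
  constructor
  · rintro ⟨h1, h2⟩
    exact ⟨h1, le_antisymm (h0 ▸ h2 _ hs) (empErr_nonneg _ _)⟩
  · rintro ⟨h1, h2⟩
    exact ⟨h1, fun h' _ => h2 ▸ empErr_nonneg _ _⟩

variable [MeasurableSpace X] {D : Fin k → Measure X} [∀ i, IsProbabilityMeasure (D i)]

instance sampleLaw.instIsProbabilityMeasure (m : Fin k → ℕ) :
    IsProbabilityMeasure (sampleLaw D m) := by
  unfold sampleLaw; infer_instance

theorem measurable_sample_eval {m : Fin k → ℕ} (i : Fin k) (j : Fin (m i)) :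
    Measurable fun U : Sample X m => U i j :=
  (measurable_pi_apply j).comp (measurable_pi_apply i)

theorem measurableSet_avoid {m : Fin k → ℕ} {A : Set X} (hA : MeasurableSet A) :
    MeasurableSet {U : Sample X m | ∀ i j, U i j ∉ A} := by
  simp only [Set.ofPred_forall]
  exact .iInter fun i => .iInter fun j => measurable_sample_eval i j hA.compl

theorem sampleLaw_avoid (m : Fin k → ℕ) {A : Set X} (hA : MeasurableSet A) :
    sampleLaw D m {U | ∀ i j, U i j ∉ A} = ∏ i, (1 - D i A) ^ m i := by
  have : {U : Sample X m | ∀ i j, U i j ∉ A} =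
      Set.univ.pi fun i => Set.univ.pi fun _ => Aᶜ := by
    ext U; simp
  rw [this, sampleLaw, Measure.pi_pi]
  simp [Measure.pi_pi, prob_compl_eq_one_sub hA]

theorem sampleLaw_eval (m : Fin k → ℕ) (i : Fin k) (j : Fin (m i)) {A : Set X}
    (hA : MeasurableSet A) : sampleLaw D m {U | U i j ∈ A} = D i A := by
  have h1 := (measurePreserving_eval (fun i => Measure.pi fun _ : Fin (m i) => D i) i)
  have h2 := (measurePreserving_eval (fun _ : Fin (m i) => D i) j)
  exact (h2.comp h1).measure_preimage hA.nullMeasurableSet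

/-- Restricting a product of probability measures along an injection of index sets. -/
theorem infinitePi_map_comp_injective {J J' : Type*} {μ : J → Measure X}
    [∀ j, IsProbabilityMeasure (μ j)] {e : J' → J} (he : e.Injective) :
    (Measure.infinitePi μ).map (fun x j' => x (e j')) = Measure.infinitePi fun j' => μ (e j') := by
  have h := (ProbabilityTheory.iIndepFun_infinitePi (P := μ) (X := fun _ => id)
    (fun _ => measurable_id)).precomp he
  rw [ProbabilityTheory.iIndepFun_iff_map_fun_eq_infinitePi_map (by fun_prop)] at h
  simpa [Measure.infinitePi_map_eval] using h

/-- Drawing samples of shape `n` and keeping, for every agent, disjoint parts of them indexed by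
`B`, each of shape `m`, yields independent samples of shape `m`. -/
theorem measurePreserving_blocks {B : Type*} [Fintype B] {m n : Fin k → ℕ}
    (e : ∀ i, B × Fin (m i) ↪ Fin (n i)) :
    MeasurePreserving (fun (U : Sample X n) (b : B) (i : Fin k) (j : Fin (m i)) => U i (e i (b, j)))
      (sampleLaw D n) (Measure.pi fun _ : B => sampleLaw D m) := by
  refine ⟨by fun_prop, ?_⟩
  -- Both laws are curried forms of products of the `D i` over the set of all single draws, and the
  -- map is a restriction along this injection of index sets.
  have hinj : Function.Injective (fun p : (_ : B) × (i : Fin k) × Fin (m i) =>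
      (⟨p.2.1, e p.2.1 (p.1, p.2.2)⟩ : (i : Fin k) × Fin (n i))) := by
    rintro ⟨b, i, j⟩ ⟨b', i', j'⟩ h
    simp only [Sigma.mk.injEq] at h
    obtain ⟨rfl, h⟩ := h
    have := (e i).injective (eq_of_heq h)
    simp_all
  have h1 : sampleLaw D n = (Measure.infinitePi fun p : (i : Fin k) × Fin (n i) => D p.1).map
      (MeasurableEquiv.piCurry fun _ _ => X) := by
    rw [Measure.infinitePi_map_piCurry (fun i (_ : Fin (n i)) => D i)]
    simp only [sampleLaw, Measure.infinitePi_eq_pi]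
  have h2 : (Measure.pi fun _ : B => sampleLaw D m) =
      ((Measure.infinitePi fun p : (_ : B) × (i : Fin k) × Fin (m i) => D p.2.1).map
        (MeasurableEquiv.piCurry fun (_ : B) (_ : (i : Fin k) × Fin (m i)) => X)).map
        (fun y b => MeasurableEquiv.piCurry (fun _ _ => X) (y b)) := by
    rw [Measure.infinitePi_map_piCurry
      (fun (_ : B) (p : (i : Fin k) × Fin (m i)) => D p.1),
      Measure.infinitePi_map_pi _ (fun _ => MeasurableEquiv.measurable _)]
    simp only [Measure.infinitePi_map_piCurry (fun i (_ : Fin (m i)) => D i)]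
    simp only [sampleLaw, Measure.infinitePi_eq_pi]
  rw [h1, h2, ← infinitePi_map_comp_injective (μ := fun p : (i : Fin k) × Fin (n i) => D p.1) hinj,
    Measure.map_map (by fun_prop) (by fun_prop), Measure.map_map (by fun_prop) (by fun_prop),
    Measure.map_map (by fun_prop) (by fun_prop)]
  rfl

end Samples

/-! ### Feasibility and the log-linear program -/

section Programs

variable {X Y : Type*} {k : ℕ} [MeasurableSpace X]

/-- Two hypotheses whose disagreement mass exceeds `ε` for some agent: the pairs which occur in the
constraints of the program. -/
abbrev FarApart (D : Fin k → Measure X) (ε : ℝ) (h₁ h₂ : X → Y) : Prop :=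
  ∃ i, ENNReal.ofReal ε < D i (dis h₁ h₂)

/-- Exponentiated form of the program: the probability that a sample of shape `m` does not
distinguish two far apart hypotheses is at most `η / |H|`. -/
theorem lpFeasible_iff {H : Set (X → Y)} {D : Fin k → Measure X} {ε η : ℝ} {m : Fin k → ℝ} :
    LPFeasible H D ε η m ↔ (∀ i, 0 ≤ m i) ∧ ∀ h₁ ∈ H, ∀ h₂ ∈ H, FarApart D ε h₁ h₂ →
      ∏ i, (1 - D i (dis h₁ h₂)) ^ m i ≤ ENNReal.ofReal (η / (H.ncard : ℝ)) := by
  have key : ∀ (s : Finset (Fin k)) (x : Fin k → ENNReal),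
      ∑ i ∈ s, ((m i : ℝ) : EReal) * ENNReal.log (x i) = ENNReal.log (∏ i ∈ s, x i ^ m i) := by
    classical
    intro s x
    induction s using Finset.induction_on with
    | empty => simp
    | insert a s ha ih =>
      rw [Finset.sum_insert ha, Finset.prod_insert ha, ENNReal.log_mul_add, ENNReal.log_rpow, ih]
  unfold LPFeasible
  simp only [key, ENNReal.log_le_log_iff]

theorem lpFeasible_natCast_iff {H : Set (X → Y)} {D : Fin k → Measure X} {ε η : ℝ}
    {m : Fin k → ℕ} :
    LPFeasible H D ε η (fun i => (m i : ℝ)) ↔ ∀ h₁ ∈ H, ∀ h₂ ∈ H, FarApart D ε h₁ h₂ →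
      ∏ i, (1 - D i (dis h₁ h₂)) ^ m i ≤ ENNReal.ofReal (η / (H.ncard : ℝ)) := by
  simp [lpFeasible_iff, ENNReal.rpow_natCast]

theorem LPFeasible.mono {H : Set (X → Y)} {D : Fin k → Measure X} {ε η : ℝ} {m m' : Fin k → ℝ}
    (hm : LPFeasible H D ε η m) (hle : ∀ i, m i ≤ m' i) : LPFeasible H D ε η m' := by
  rw [lpFeasible_iff] at hm ⊢
  refine ⟨fun i => (hm.1 i).trans (hle i), fun h₁ hh₁ h₂ hh₂ hb => ?_⟩
  refine le_trans ?_ (hm.2 h₁ hh₁ h₂ hh₂ hb)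
  exact Finset.prod_le_prod' fun i _ => ENNReal.rpow_le_rpow_of_exponent_ge tsub_le_self (hle i)

theorem LPFeasible.roundUp {H : Set (X → Y)} {D : Fin k → Measure X} {ε η : ℝ} {m : Fin k → ℝ}
    (hm : LPFeasible H D ε η m) : LPFeasible H D ε η (fun i => (roundUp m i : ℝ)) :=
  hm.mono fun i => Nat.le_ceil (m i)

variable {D : Fin k → Measure X}

/-- Equal contributions of size `M` solve the program when `M` is of order `log (|H| / η) / ε`. -/
theorem lpFeasible_const {H : Set (X → Y)} {ε η : ℝ} (hε : 0 ≤ ε) {M : ℕ}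
    (hM : H.Nonempty → Real.exp (-(ε * M)) ≤ η / (H.ncard : ℝ)) :
    LPFeasible H D ε η (fun _ => (M : ℝ)) := by
  classical
  rw [lpFeasible_natCast_iff (m := fun _ => M)]
  rintro h₁ hh₁ h₂ hh₂ ⟨i, hi⟩
  have h1 : 1 - D i (dis h₁ h₂) ≤ ENNReal.ofReal (Real.exp (-ε)) := by
    calc 1 - D i (dis h₁ h₂) ≤ 1 - ENNReal.ofReal ε := tsub_le_tsub_left hi.le _
      _ = ENNReal.ofReal (1 - ε) := by rw [ENNReal.ofReal_sub _ hε, ENNReal.ofReal_one]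
      _ ≤ _ := ENNReal.ofReal_le_ofReal (by linarith [Real.add_one_le_exp (-ε)])
  rw [← Finset.mul_prod_erase _ _ (Finset.mem_univ i)]
  calc _ ≤ (1 - D i (dis h₁ h₂)) ^ M * 1 := by
        gcongr
        exact Finset.prod_le_one' fun j _ => pow_le_one' tsub_le_self _
    _ ≤ ENNReal.ofReal (Real.exp (-ε)) ^ M := by rw [mul_one]; gcongr
    _ = ENNReal.ofReal (Real.exp (-(ε * M))) := by
        rw [← ENNReal.ofReal_pow (Real.exp_pos _).le, ← Real.exp_nat_mul]
        congr 2; ring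
    _ ≤ _ := ENNReal.ofReal_le_ofReal (hM ⟨h₁, hh₁⟩)

theorem exp_neg_mul_ceil_le {ε x : ℝ} (hε : 0 < ε) (hx : 0 < x) :
    Real.exp (-(ε * (⌈Real.log x / ε⌉₊ : ℝ))) ≤ 1 / x := by
  have h : Real.log x ≤ ε * (⌈Real.log x / ε⌉₊ : ℝ) := by
    rw [← div_le_iff₀' hε]; exact Nat.le_ceil _
  calc _ ≤ Real.exp (-Real.log x) := Real.exp_le_exp.2 (by linarith)
    _ = 1 / x := by rw [Real.exp_neg, Real.exp_log hx, one_div]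

theorem lpFeasible_const_ceil {H : Set (X → Y)} (hH : H.Finite) {ε η : ℝ} (hε : 0 < ε)
    (hη : 0 < η) :
    LPFeasible H D ε η (fun _ => (⌈Real.log (H.ncard / η) / ε⌉₊ : ℝ)) := by
  refine lpFeasible_const hε.le fun hne => ?_
  have : 0 < (H.ncard : ℝ) := by exact_mod_cast (Set.ncard_pos hH).2 hne
  simpa using exp_neg_mul_ceil_le hε (div_pos this hη)

theorem cost_mono {c : Fin k → ℝ} (hc : ∀ i, 0 < c i) {m m' : Fin k → ℝ} (h : ∀ i, m i ≤ m' i) :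
    cost c m ≤ cost c m' :=
  Finset.sum_le_sum fun i _ => mul_le_mul_of_nonneg_left (h i) (hc i).le

theorem cost_smul (c : Fin k → ℝ) (r : ℝ) (m : Fin k → ℝ) :
    cost c (fun i => r * m i) = r * cost c m := by
  simp only [cost, Finset.mul_sum]
  exact Finset.sum_congr rfl fun i _ => by ring

theorem cost_nonneg {c : Fin k → ℝ} (hc : ∀ i, 0 < c i) {m : Fin k → ℝ} (h : ∀ i, 0 ≤ m i) :
    0 ≤ cost c m :=
  Finset.sum_nonneg fun i _ => mul_nonneg (hc i).le (h i)

theorem le_cost_div {c : Fin k → ℝ} (hc : ∀ i, 0 < c i) {m : Fin k → ℝ} (h : ∀ i, 0 ≤ m i)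
    (i : Fin k) : m i ≤ cost c m / c i := by
  rw [le_div_iff₀' (hc i)]
  exact Finset.single_le_sum (f := fun i => c i * m i) (fun i _ => mul_nonneg (hc i).le (h i))
    (Finset.mem_univ i)

theorem cost_roundUp_le {c : Fin k → ℝ} (hc : ∀ i, 0 < c i) {m : Fin k → ℝ} (h : ∀ i, 0 ≤ m i) :
    cost c (fun i => (roundUp m i : ℝ)) ≤ cost c m + ∑ i, c i := by
  simp only [cost, ← Finset.sum_add_distrib]
  refine Finset.sum_le_sum fun i _ => ?_
  have := (Nat.ceil_lt_add_one (h i)).le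
  calc c i * (roundUp m i : ℝ) ≤ c i * (m i + 1) := mul_le_mul_of_nonneg_left this (hc i).le
    _ = _ := by ring

theorem exists_isIntLPSolution {H : Set (X → Y)} (hH : H.Finite) {c : Fin k → ℝ}
    (hc : ∀ i, 0 < c i) {ε η : ℝ} (hε : 0 < ε) (hη : 0 < η) :
    ∃ m, IsIntLPSolution H D c ε η m := by
  set m₀ : Fin k → ℕ := fun _ => ⌈Real.log (H.ncard / η) / ε⌉₊ with hm₀
  have hf₀ : LPFeasible H D ε η (fun i => (m₀ i : ℝ)) := lpFeasible_const_ceil hH hε hη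
  set K := cost c (fun i => (m₀ i : ℝ)) with hK
  -- As all costs are positive, only finitely many integral vectors cost at most as much as `m₀`.
  set S : Set (Fin k → ℕ) := {m | LPFeasible H D ε η (fun i => (m i : ℝ)) ∧
    cost c (fun i => (m i : ℝ)) ≤ K}
  have hSfin : S.Finite := by
    refine (Set.finite_Iic (fun i => ⌊K / c i⌋₊)).subset fun m hm i => Nat.le_floor ?_
    exact (le_cost_div hc (fun i => Nat.cast_nonneg (m i)) i).trans
      (div_le_div_of_nonneg_right hm.2 (hc i).le)
  obtain ⟨m, hm, hmin⟩ := Set.exists_min_image S (fun m => cost c (fun i => (m i : ℝ))) hSfin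
    ⟨m₀, hf₀, le_rfl⟩
  refine ⟨m, hm.1, fun m' hm' => ?_⟩
  by_cases h : cost c (fun i => (m' i : ℝ)) ≤ K
  · exact hmin m' ⟨hm', h⟩
  · exact hm.2.trans (not_le.1 h).le

variable [∀ i, IsProbabilityMeasure (D i)]

/-- It suffices to bound the outer probability that some far hypothesis is consistent with the
target on the whole sample. -/
theorem requirement_of_measure_le {H : Set (X → Y)} {ε δ : ℝ} (hδ : 0 ≤ δ) {i : Fin k}
    {m : Fin k → ℕ}
    (h : ∀ hstar ∈ H, sampleLaw D m {U | ∃ h ∈ H, ENNReal.ofReal ε < D i (dis h hstar) ∧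
      ∀ i j, U i j ∉ dis h hstar} ≤ ENNReal.ofReal δ) :
    Requirement H D ε δ i m := by
  intro hstar hs
  rw [ENNReal.ofReal_sub _ hδ, ENNReal.ofReal_one, tsub_le_iff_right]
  refine le_trans ?_ (add_le_add_right (h hstar hs) _)
  rw [← measure_univ (μ := sampleLaw D m)]
  refine (measure_mono fun U _ => ?_).trans (measure_union_le _ _)
  by_contra hU
  simp only [Set.mem_union, Set.mem_ofPred_eq, not_or, not_exists, not_and] at hU
  refine hU.1 (iSup₂_le fun h' hh' => ?_)
  rw [mem_ERM_pooled hs] at hh'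
  by_contra! hlt
  exact hU.2 h' hh'.1 hlt hh'.2

/-- Under a feasible contribution vector the sample distinguishes any two far apart hypotheses with
probability at least `1 - δ`: otherwise one of them, as target, would have the other one as an
empirical risk minimizer. -/
theorem PACFeasible.prod_le {H : Set (X → Y)} {ε δ : ℝ} (hδ : 0 ≤ δ) (hδ1 : δ ≤ 1)
    {m : Fin k → ℕ} (hm : PACFeasible H D ε δ m) {h₁ h₂ : X → Y} (hh₁ : h₁ ∈ H) (hh₂ : h₂ ∈ H)
    (hmeas : MeasurableSet (dis h₁ h₂)) (hfar : FarApart D ε h₁ h₂) :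
    ∏ i, (1 - D i (dis h₁ h₂)) ^ m i ≤ ENNReal.ofReal δ := by
  obtain ⟨i, hi⟩ := hfar
  rw [← sampleLaw_avoid m hmeas]
  have hreq := hm i h₂ hh₂
  set G := {U : Sample X m | errERM H (D i) h₂ (pooled h₂ U) ≤ ENNReal.ofReal ε}
  set B := {U : Sample X m | ∀ i j, U i j ∉ dis h₁ h₂}
  have hdisj : Disjoint G B := by
    rw [Set.disjoint_left]
    intro U hG hB
    have hmem : h₁ ∈ ERM H (pooled h₂ U) := (mem_ERM_pooled hh₂ U h₁).2 ⟨hh₁, hB⟩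
    exact absurd ((le_iSup₂ (f := fun h (_ : h ∈ ERM H (pooled h₂ U)) => D i (dis h h₂))
      h₁ hmem).trans hG) (not_le.2 hi)
  have hsum : sampleLaw D m G + sampleLaw D m B ≤ 1 := by
    rw [← measure_union hdisj (measurableSet_avoid hmeas)]
    exact prob_le_one
  have h1 : ENNReal.ofReal (1 - δ) + sampleLaw D m B ≤
      ENNReal.ofReal (1 - δ) + ENNReal.ofReal δ := by
    rw [← ENNReal.ofReal_add (by linarith) hδ]
    simpa using (add_le_add_left hreq _).trans hsum
  exact (ENNReal.add_le_add_iff_left ENNReal.ofReal_ne_top).1 h1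

/-- Scaling a feasible contribution vector by `r`, where `δ ^ r ≤ η / |H'|`, solves the program of a
finite subclass. -/
theorem PACFeasible.lpFeasible_smul {H H' : Set (X → Y)} {ε δ η r : ℝ} (hδ : 0 ≤ δ)
    (hδ1 : δ ≤ 1) (hr : 0 ≤ r) (hsub : H' ⊆ H)
    (hmeas : ∀ h₁ ∈ H, ∀ h₂ ∈ H, MeasurableSet (dis h₁ h₂))
    (hpow : H'.Nonempty → δ ^ r ≤ η / (H'.ncard : ℝ))
    {m : Fin k → ℕ} (hm : PACFeasible H D ε δ m) :
    LPFeasible H' D ε η (fun i => r * (m i : ℝ)) := by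
  rw [lpFeasible_iff]
  refine ⟨fun i => by positivity, fun h₁ hh₁ h₂ hh₂ hb => ?_⟩
  have h1 := hm.prod_le hδ hδ1 (hsub hh₁) (hsub hh₂) (hmeas _ (hsub hh₁) _ (hsub hh₂)) hb
  have h2 : ∏ i, (1 - D i (dis h₁ h₂)) ^ (r * (m i : ℝ)) =
      (∏ i, (1 - D i (dis h₁ h₂)) ^ m i) ^ r := by
    rw [← ENNReal.prod_rpow_of_nonneg hr]
    refine Finset.prod_congr rfl fun i _ => ?_
    rw [mul_comm, ENNReal.rpow_mul, ENNReal.rpow_natCast]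
  rw [h2]
  refine (ENNReal.rpow_le_rpow h1 hr).trans ?_
  rw [ENNReal.ofReal_rpow_of_nonneg hδ hr]
  exact ENNReal.ofReal_le_ofReal (hpow ⟨h₁, hh₁⟩)

theorem rpow_log_div_log {δ x : ℝ} (hδ : 0 < δ) (hδ1 : δ < 1) (hx : 0 < x) :
    δ ^ (Real.log x / Real.log (1 / δ)) = 1 / x := by
  have h : Real.log δ < 0 := Real.log_neg hδ hδ1
  rw [Real.rpow_def_of_pos hδ, one_div δ, Real.log_inv]
  have : Real.log δ * (Real.log x / -Real.log δ) = -Real.log x := by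
    rw [div_neg, mul_neg, mul_div_cancel₀ _ h.ne]
  rw [this, Real.exp_neg, Real.exp_log hx, one_div]

/-- If no logarithm in the constraints is infinite, the sublevel sets of the program are compact,
so that an optimum is attained. -/
theorem exists_isLPSolution {H : Set (X → Y)} (hH : H.Finite) {c : Fin k → ℝ}
    (hc : ∀ i, 0 < c i) {ε η : ℝ} (hε : 0 < ε) (hη : 0 < η)
    (hne : ∀ h₁ ∈ H, ∀ h₂ ∈ H, FarApart D ε h₁ h₂ → ∀ i, D i (dis h₁ h₂) ≠ 1) :
    ∃ m, IsLPSolution H D c ε η m := by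
  set m₀ : Fin k → ℝ := fun _ => (⌈Real.log (H.ncard / η) / ε⌉₊ : ℝ) with hm₀
  have hf₀ : LPFeasible H D ε η m₀ := lpFeasible_const_ceil hH hε hη
  set K := cost c m₀ with hK
  have hcont : Continuous (cost c) := by unfold cost; fun_prop
  set S : Set (Fin k → ℝ) := {m | LPFeasible H D ε η m ∧ cost c m ≤ K}
  have hclosed : IsClosed S := by
    have hS : S = ({m | ∀ i, 0 ≤ m i} ∩ ⋂ h₁ ∈ H, ⋂ h₂ ∈ H, ⋂ (_ : FarApart D ε h₁ h₂),
        {m | ∏ i, (1 - D i (dis h₁ h₂)) ^ m i ≤ ENNReal.ofReal (η / (H.ncard : ℝ))}) ∩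
        {m | cost c m ≤ K} := by
      ext m; simp [S, lpFeasible_iff]
    rw [hS]
    refine (IsClosed.inter ?_ ?_).inter (isClosed_le hcont continuous_const)
    · simp only [Set.ofPred_forall]
      exact isClosed_iInter fun i => isClosed_le continuous_const (continuous_apply i)
    · refine isClosed_biInter fun h₁ hh₁ => isClosed_biInter fun h₂ hh₂ =>
        isClosed_iInter fun hb => isClosed_le ?_ continuous_const
      have hpos : ∀ i, 0 < 1 - D i (dis h₁ h₂) := fun i =>
        tsub_pos_of_lt (lt_of_le_of_ne prob_le_one (hne h₁ hh₁ h₂ hh₂ hb i))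
      have hfin : ∀ i, 1 - D i (dis h₁ h₂) ≠ ⊤ := fun i =>
        (tsub_le_self.trans_lt ENNReal.one_lt_top).ne
      have hpos' : ∀ i, 0 < (1 - D i (dis h₁ h₂)).toReal := fun i =>
        ENNReal.toReal_pos (hpos i).ne' (hfin i)
      have : (fun m : Fin k → ℝ => ∏ i, (1 - D i (dis h₁ h₂)) ^ m i) = fun m =>
          ENNReal.ofReal (∏ i, (1 - D i (dis h₁ h₂)).toReal ^ m i) := by
        ext m
        rw [ENNReal.ofReal_prod_of_nonneg fun i _ => Real.rpow_nonneg (hpos' i).le _]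
        refine Finset.prod_congr rfl fun i _ => ?_
        rw [← ENNReal.ofReal_rpow_of_pos (hpos' i), ENNReal.ofReal_toReal (hfin i)]
      rw [this]
      refine ENNReal.continuous_ofReal.comp (continuous_finsetProd _ fun i _ => ?_)
      exact continuous_const.rpow (continuous_apply i) fun m => Or.inl (hpos' i).ne'
  have hcompact : IsCompact S := by
    refine isCompact_Icc.of_isClosed_subset hclosed
      (s := Set.Icc (0 : Fin k → ℝ) (fun i => K / c i)) fun m hm => ?_
    exact ⟨hm.1.1, fun i => (le_cost_div hc hm.1.1 i).trans
      (div_le_div_of_nonneg_right hm.2 (hc i).le)⟩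
  obtain ⟨m, hm, hmin⟩ := hcompact.exists_isMinOn ⟨m₀, hf₀, le_rfl⟩ hcont.continuousOn
  refine ⟨m, hm.1, fun m' hm' => ?_⟩
  by_cases h : cost c m' ≤ K
  · exact hmin ⟨hm', h⟩
  · exact hm.2.trans (not_le.1 h).le

end Programs

/-! ### Finite classes -/

section FiniteClasses

variable {X Y : Type*} {k : ℕ} [MeasurableSpace X] {D : Fin k → Measure X}
  [∀ i, IsProbabilityMeasure (D i)] {H : Set (X → Y)}

/-- A union bound over the class. -/
theorem pacFeasible_of_lpFeasible (hH : H.Finite)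
    (hmeas : ∀ h₁ ∈ H, ∀ h₂ ∈ H, MeasurableSet (dis h₁ h₂)) {ε δ : ℝ} (hδ : 0 ≤ δ)
    {m : Fin k → ℕ} (hm : LPFeasible H D ε δ (fun i => (m i : ℝ))) : PACFeasible H D ε δ m := by
  intro i
  rw [lpFeasible_natCast_iff] at hm
  refine requirement_of_measure_le hδ fun hstar hs => ?_
  have hpos : 0 < H.ncard := (Set.ncard_pos hH).2 ⟨hstar, hs⟩
  have hsub : {U : Sample X m | ∃ h ∈ H, ENNReal.ofReal ε < D i (dis h hstar) ∧
      ∀ i j, U i j ∉ dis h hstar} ⊆ ⋃ h ∈ hH.toFinset, {U : Sample X m |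
        ENNReal.ofReal ε < D i (dis h hstar) ∧ ∀ i j, U i j ∉ dis h hstar} := by
    rintro U ⟨h, hh, hU⟩
    simp only [Set.mem_iUnion]
    exact ⟨h, hH.mem_toFinset.2 hh, hU⟩
  refine (measure_mono hsub).trans ((measure_biUnion_finset_le _ _).trans ?_)
  calc _ ≤ ∑ _h ∈ hH.toFinset, ENNReal.ofReal (δ / (H.ncard : ℝ)) := by
        refine Finset.sum_le_sum fun h hh => ?_
        rw [hH.mem_toFinset] at hh
        by_cases hfar : ENNReal.ofReal ε < D i (dis h hstar)
        · refine le_trans (measure_mono (t := {U : Sample X m | ∀ i j, U i j ∉ dis h hstar})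
            fun U hU => hU.2) ?_
          rw [sampleLaw_avoid m (hmeas h hh hstar hs)]
          exact hm h hh hstar hs ⟨i, hfar⟩
        · simp [hfar]
    _ = ENNReal.ofReal δ := by
        rw [Finset.sum_const, ← Set.ncard_eq_toFinset_card H hH, nsmul_eq_mul,
          ← ENNReal.ofReal_natCast, ← ENNReal.ofReal_mul (Nat.cast_nonneg _)]
        congr 1
        field_simp

theorem one_le_finiteFactor (N : ℕ) {δ : ℝ} (hδ : 0 < δ) (hδ1 : δ < 1) :
    1 ≤ finiteFactor N δ := by
  have h : 0 < Real.log (1 / δ) := Real.log_pos (by rw [lt_div_iff₀ hδ]; linarith)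
  rw [finiteFactor, le_div_iff₀ h]
  linarith [Real.log_natCast_nonneg N]

theorem rpow_finiteFactor {N : ℕ} (hN : 0 < N) {δ : ℝ} (hδ : 0 < δ) (hδ1 : δ < 1) :
    δ ^ finiteFactor N δ = δ / N := by
  have hN' : (0 : ℝ) < N := by exact_mod_cast hN
  rw [finiteFactor, ← Real.log_mul (by positivity) hN'.ne',
    rpow_log_div_log hδ hδ1 (by positivity)]
  field_simp

/-- Approximation by the linear program and its integer version for finite classes. -/
theorem finite_classes (hH : H.Finite)
    (hmeas : ∀ h₁ ∈ H, ∀ h₂ ∈ H, MeasurableSet (dis h₁ h₂)) {c : Fin k → ℝ} (hc : ∀ i, 0 < c i)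
    {ε δ : ℝ} (hε : 0 < ε) (hδ : 0 < δ) (hδ1 : δ < 1) :
    ((∀ h₁ ∈ H, ∀ h₂ ∈ H, FarApart D ε h₁ h₂ → ∀ i, D i (dis h₁ h₂) ≠ 1) →
        ∃ m, IsLPSolution H D c ε δ m) ∧
      (∀ m, IsLPSolution H D c ε δ m →
        PACFeasible H D ε δ (roundUp m) ∧
        ∀ m' : Fin k → ℕ, PACFeasible H D ε δ m' →
          cost c m ≤ finiteFactor H.ncard δ * cost c (fun i => (m' i : ℝ)) ∧
          cost c (fun i => (roundUp m i : ℝ)) ≤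
            finiteFactor H.ncard δ * cost c (fun i => (m' i : ℝ)) + ∑ i, c i) ∧
      (∃ m, IsIntLPSolution H D c ε δ m) ∧
      (∀ m, IsIntLPSolution H D c ε δ m →
        PACFeasible H D ε δ m ∧
        ∀ m' : Fin k → ℕ, PACFeasible H D ε δ m' →
          cost c (fun i => (m i : ℝ)) ≤
            (⌈finiteFactor H.ncard δ⌉₊ : ℝ) * cost c (fun i => (m' i : ℝ))) := by
  have hr := one_le_finiteFactor H.ncard hδ hδ1
  refine ⟨exists_isLPSolution hH hc hε hδ, fun m hm => ?_, exists_isIntLPSolution hH hc hε hδ,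
    fun m hm => ⟨pacFeasible_of_lpFeasible hH hmeas hδ.le hm.1, fun m' hm' => ?_⟩⟩
  · refine ⟨pacFeasible_of_lpFeasible hH hmeas hδ.le hm.1.roundUp, fun m' hm' => ?_⟩
    have h1 : cost c m ≤ finiteFactor H.ncard δ * cost c (fun i => (m' i : ℝ)) := by
      rw [← cost_smul]
      refine hm.2 _ (hm'.lpFeasible_smul hδ.le hδ1.le (by linarith) subset_rfl hmeas fun hne => ?_)
      exact (rpow_finiteFactor ((Set.ncard_pos hH).2 hne) hδ hδ1).le
    exact ⟨h1, (cost_roundUp_le hc hm.1.1).trans (by linarith)⟩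
  · rw [← cost_smul]
    have h := hm.2 (fun i => ⌈finiteFactor H.ncard δ⌉₊ * m' i)
    simp only [Nat.cast_mul] at h
    refine h (hm'.lpFeasible_smul hδ.le hδ1.le (by positivity) subset_rfl hmeas fun hne => ?_)
    rw [← rpow_finiteFactor ((Set.ncard_pos hH).2 hne) hδ hδ1]
    exact Real.rpow_le_rpow_of_exponent_ge hδ hδ1.le (Nat.le_ceil _)

end FiniteClasses

/-! ### Symmetrization -/

section Symmetrization

variable {Ω : Type*} {t q : ℕ}

/-- Exchange of the entries of two sequences at the positions selected by `σ`. -/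
def swapAt (σ : Fin t → Bool) (z : (Fin t → Ω) × (Fin t → Ω)) : (Fin t → Ω) × (Fin t → Ω) :=
  (fun b => if σ b then z.2 b else z.1 b, fun b => if σ b then z.1 b else z.2 b)

theorem measurePreserving_swapAt [MeasurableSpace Ω] (P : Measure Ω) [IsProbabilityMeasure P]
    (σ : Fin t → Bool) :
    MeasurePreserving (swapAt (Ω := Ω) σ)
      ((Measure.pi fun _ => P).prod (Measure.pi fun _ => P))
      ((Measure.pi fun _ => P).prod (Measure.pi fun _ => P)) := by
  have h1 := measurePreserving_arrowProdEquivProdArrow Ω Ω (Fin t) (fun _ => P) (fun _ => P)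
  have h2 : MeasurePreserving (fun (x : Fin t → Ω × Ω) b => if σ b then (x b).swap else x b)
      (Measure.pi fun _ => P.prod P) (Measure.pi fun _ => P.prod P) := by
    refine measurePreserving_pi (f := fun b (p : Ω × Ω) => if σ b then p.swap else p) _ _
      fun b => ?_
    by_cases hb : σ b
    · simpa [hb] using Measure.measurePreserving_swap (μ := P) (ν := P)
    · simp only [hb, Bool.false_eq_true, if_false]
      exact MeasurePreserving.id _
  have h3 := (h1.comp h2).comp (h1.symm _)
  convert h3 using 1
  ext z b <;> by_cases hb : σ b <;> simp [swapAt, hb, MeasurableEquiv.arrowProdEquivProdArrow]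

open Classical in
/-- Among all exchanges of two sequences of `2 q` outcomes, at most `2 ^ q` move every success out
of the first sequence while leaving at least `q` successes in the second one: the exchange is
forced at each position carrying a success. -/
theorem card_swaps_le (s₁ s₂ : Set (Fin (2 * q))) :
    (Finset.univ.filter fun σ : Fin (2 * q) → Bool =>
      (∀ b, ¬ (if σ b then b ∈ s₂ else b ∈ s₁)) ∧
        q ≤ (Finset.univ.filter fun b => if σ b then b ∈ s₁ else b ∈ s₂).card).card ≤ 2 ^ q := by
  set F := Finset.univ.filter fun σ : Fin (2 * q) → Bool =>
      (∀ b, ¬ (if σ b then b ∈ s₂ else b ∈ s₁)) ∧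
        q ≤ (Finset.univ.filter fun b => if σ b then b ∈ s₁ else b ∈ s₂).card with hF
  set E : Finset (Fin (2 * q)) := Finset.univ.filter fun b => b ∈ s₁ ∨ b ∈ s₂ with hE
  rcases F.eq_empty_or_nonempty with h0 | ⟨σ₀, hσ₀⟩
  · simp [h0]
  have hEcard : q ≤ E.card := by
    refine (Finset.mem_filter.1 hσ₀).2.2.trans (Finset.card_le_card fun b hb => ?_)
    simp only [hE, Finset.mem_filter, Finset.mem_univ, true_and] at hb ⊢
    split_ifs at hb <;> tauto
  have hsub : F ⊆ Fintype.piFinset fun b =>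
      if b ∈ E then {decide (b ∈ s₁)} else (Finset.univ : Finset Bool) := by
    intro σ hσ
    rw [Fintype.mem_piFinset]
    intro b
    have h1 := (Finset.mem_filter.1 hσ).2.1 b
    by_cases hb : b ∈ E
    · have hb' : b ∈ s₁ ∨ b ∈ s₂ := by simpa [hE] using hb
      rw [if_pos hb, Finset.mem_singleton]
      by_cases hs : σ b = true
      · simp only [hs, if_true] at h1
        simp [hs, hb'.resolve_right h1]
      · rw [if_neg hs] at h1
        simp [h1, Bool.eq_false_iff.2 hs]
    · simp [hb]
  refine (Finset.card_le_card hsub).trans ?_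
  rw [Fintype.card_piFinset]
  have : ∀ b : Fin (2 * q), (if b ∈ E then {decide (b ∈ s₁)} else (Finset.univ : Finset Bool)).card
      = if b ∈ Eᶜ then 2 else 1 := by
    intro b; by_cases hb : b ∈ E <;> simp [hb]
  simp only [this]
  rw [← Finset.prod_filter, Finset.prod_const, Finset.filter_mem_eq_inter, Finset.univ_inter,
    Finset.card_compl, Fintype.card_fin]
  exact Nat.pow_le_pow_right (by norm_num) (by omega)

variable [MeasurableSpace Ω] {P : Measure Ω} [IsProbabilityMeasure P]

open Classical in
/-- At least half of `2 q` independent trials succeed with probability at least `1 / 2`, if each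
one fails with probability at most `1 / 4`. -/
theorem half_le_pi_many_successes {A : Set Ω} (hA : MeasurableSet A) (hP : P Aᶜ ≤ 1 / 4) :
    1 / 2 ≤ Measure.pi (fun _ : Fin (2 * q) => P)
      {y | q ≤ (Finset.univ.filter fun b => y b ∈ A).card} := by
  set S := {y : Fin (2 * q) → Ω | q ≤ (Finset.univ.filter fun b => y b ∈ A).card}
  rcases Nat.eq_zero_or_pos q with rfl | hq
  · have : S = Set.univ := by ext; simp [S]
    rw [this, measure_univ]
    simp
  -- Markov's inequality for the number `f` of failures, whose expectation is at most `q / 2`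
  set f : (Fin (2 * q) → Ω) → ENNReal := fun y => ∑ b, Aᶜ.indicator 1 (y b) with hf
  have hfm : Measurable f := Finset.measurable_sum _ fun b _ =>
    ((measurable_one.indicator hA.compl).comp (measurable_pi_apply b))
  have hint : ∫⁻ y, f y ∂(Measure.pi fun _ => P) ≤ q * (1 / 2) := by
    simp only [hf]
    rw [lintegral_finsetSum _ fun b _ => by
      exact (measurable_one.indicator hA.compl).comp (measurable_pi_apply b)]
    have hb : ∀ b : Fin (2 * q), ∫⁻ y, Aᶜ.indicator (1 : Ω → ENNReal) (y b)
        ∂(Measure.pi fun _ => P) = P Aᶜ := by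
      intro b
      rw [(measurePreserving_eval (fun _ : Fin (2 * q) => P) b).lintegral_comp
        (measurable_one.indicator hA.compl), lintegral_indicator_one hA.compl]
    simp only [hb, Finset.sum_const, Finset.card_univ, Fintype.card_fin, nsmul_eq_mul]
    calc ((2 * q : ℕ) : ENNReal) * P Aᶜ ≤ (2 * q : ℕ) * (1 / 4) := by gcongr
      _ = q * (1 / 2) := by
        rw [show (1 / 2 : ENNReal) = 2 * (1 / 4) by
          rw [← ENNReal.toReal_eq_toReal_iff' (by finiteness) (by finiteness)]; norm_num]
        push_cast; ring
  have hmarkov : Measure.pi (fun _ : Fin (2 * q) => P) Sᶜ ≤ 1 / 2 := by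
    have h1 : Sᶜ ⊆ {y | (q : ENNReal) ≤ f y} := by
      intro y hy
      have hfy : f y = (Finset.univ.filter fun b => ¬ y b ∈ A).card := by
        simp only [hf, Set.indicator_apply, Set.mem_compl_iff, Pi.one_apply]
        rw [← Finset.sum_filter, Finset.sum_const, nsmul_eq_mul, mul_one]
      have hsum := Finset.card_filter_add_card_filter_not (s := Finset.univ) (fun b => y b ∈ A)
      rw [Finset.card_univ, Fintype.card_fin] at hsum
      simp only [S, Set.mem_compl_iff, Set.mem_ofPred_eq, not_le] at hy ⊢
      rw [hfy]
      exact_mod_cast (by omega)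
    have h2 := (mul_meas_ge_le_lintegral hfm (q : ENNReal)).trans hint
    refine (measure_mono h1).trans ?_
    exact (ENNReal.mul_le_mul_iff_right (by exact_mod_cast hq.ne') (by finiteness)).1 h2
  have hall : (1 : ENNReal) ≤ Measure.pi (fun _ : Fin (2 * q) => P) S + 1 / 2 := by
    have hu := measure_univ (μ := Measure.pi fun _ : Fin (2 * q) => P)
    rw [← Set.union_compl_self S] at hu
    exact hu.symm.trans_le ((measure_union_le _ _).trans (add_le_add_right hmarkov _))
  have := tsub_le_iff_right.2 hall
  rwa [show (1 : ENNReal) - 1 / 2 = 1 / 2 by simp] at this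

open Classical in
/-- The event that some set of the family is missed by the whole first sequence but hit by at least
`q` entries of the second one. -/
def ghostEvent {ι : Type*} (A : ι → Set Ω) (q : ℕ) :
    Set ((Fin (2 * q) → Ω) × (Fin (2 * q) → Ω)) :=
  {z | ∃ h, (∀ b, z.1 b ∉ A h) ∧ q ≤ (Finset.univ.filter fun b => z.2 b ∈ A h).card}

/-- Introduction of a ghost sample: given that a set of large measure is missed by the first
sequence, an independent second one hits it often with probability at least `1 / 2`. -/
theorem pi_exists_avoid_le_ghostEvent {ι : Type*} {A : ι → Set Ω} {I : Set ι}
    (hA : ∀ h ∈ I, MeasurableSet (A h)) (hP : ∀ h ∈ I, P (A h)ᶜ ≤ 1 / 4) :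
    Measure.pi (fun _ : Fin (2 * q) => P) {x | ∃ h ∈ I, ∀ b, x b ∉ A h} ≤
      2 * ((Measure.pi fun _ : Fin (2 * q) => P).prod (Measure.pi fun _ => P))
        (ghostEvent A q) := by
  classical
  set Q := Measure.pi fun _ : Fin (2 * q) => P
  -- Fubini and Markov are applied to a measurable hull, so no measurability is assumed here.
  set E := toMeasurable (Q.prod Q) (ghostEvent A q)
  have hE : MeasurableSet E := measurableSet_toMeasurable _ _
  have hsub : {x | ∃ h ∈ I, ∀ b, x b ∉ A h} ⊆ {x | 1 / 2 ≤ Q (Prod.mk x ⁻¹' E)} := by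
    rintro x ⟨h, hI, hx⟩
    refine (half_le_pi_many_successes (q := q) (hA h hI) (hP h hI)).trans (measure_mono ?_)
    intro y hy
    exact subset_toMeasurable _ _ ⟨h, hx, hy⟩
  have h1 := mul_meas_ge_le_lintegral (μ := Q)
    (measurable_measure_prodMk_left (ν := Q) hE) (1 / 2)
  rw [← Measure.prod_apply hE, measure_toMeasurable] at h1
  calc _ ≤ Q {x | 1 / 2 ≤ Q (Prod.mk x ⁻¹' E)} := measure_mono hsub
    _ = 2 * (1 / 2 * Q {x | 1 / 2 ≤ Q (Prod.mk x ⁻¹' E)}) := by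
        rw [← mul_assoc, one_div, ENNReal.mul_inv_cancel (by norm_num) (by norm_num), one_mul]
    _ ≤ _ := by gcongr

/-- Averaging over all exchanges between the two samples, with a union bound over the traces of the
family. Null measurability of the event is what permits to interchange the average and the
integral. -/
theorem ghostEvent_mul_le {ι : Type*} {A : ι → Set Ω} {G : ℕ}
    (htr : ∀ z : (Fin (2 * q) → Ω) × (Fin (2 * q) → Ω),
      (Set.range fun h => (({b | z.1 b ∈ A h}, {b | z.2 b ∈ A h}) :
        Set (Fin (2 * q)) × Set (Fin (2 * q)))).ncard ≤ G)
    (hnull : NullMeasurableSet (ghostEvent A q)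
      ((Measure.pi fun _ : Fin (2 * q) => P).prod (Measure.pi fun _ => P))) :
    ((Measure.pi fun _ : Fin (2 * q) => P).prod (Measure.pi fun _ => P))
      (ghostEvent A q) * 2 ^ q ≤ G := by
  classical
  set μ := (Measure.pi fun _ : Fin (2 * q) => P).prod
    (Measure.pi fun _ : Fin (2 * q) => P)
  have hnull' : ∀ σ : Fin (2 * q) → Bool, NullMeasurableSet (swapAt σ ⁻¹' ghostEvent A q) μ :=
    fun σ => hnull.preimage (measurePreserving_swapAt P σ).quasiMeasurePreserving
  have hcount : ∀ z : (Fin (2 * q) → Ω) × (Fin (2 * q) → Ω), ∑ σ : Fin (2 * q) → Bool,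
      (swapAt σ ⁻¹' ghostEvent A q).indicator (fun _ => (1 : ENNReal)) z ≤ G * 2 ^ q := by
    intro z
    simp only [Set.indicator_apply, ← Finset.sum_filter, Finset.sum_const, nsmul_eq_mul, mul_one]
    set R := Set.range fun h => (({b | z.1 b ∈ A h}, {b | z.2 b ∈ A h}) :
        Set (Fin (2 * q)) × Set (Fin (2 * q))) with hR
    have hRfin : R.Finite := Set.toFinite _
    have hle : (Finset.univ.filter fun σ : Fin (2 * q) → Bool =>
        z ∈ swapAt σ ⁻¹' ghostEvent A q).card ≤ G * 2 ^ q := by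
      refine (Finset.card_le_card (t := hRfin.toFinset.biUnion fun τ =>
        Finset.univ.filter fun σ : Fin (2 * q) → Bool =>
          (∀ b, ¬ (if σ b then b ∈ τ.2 else b ∈ τ.1)) ∧
          q ≤ (Finset.univ.filter fun b => if σ b then b ∈ τ.1 else b ∈ τ.2).card) ?_).trans ?_
      · intro σ hσ
        obtain ⟨h, h1, h2⟩ := (Finset.mem_filter.1 hσ).2
        rw [Finset.mem_biUnion]
        refine ⟨({b | z.1 b ∈ A h}, {b | z.2 b ∈ A h}), hRfin.mem_toFinset.2 ⟨h, rfl⟩, ?_⟩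
        rw [Finset.mem_filter]
        refine ⟨Finset.mem_univ _, fun b => ?_, h2.trans (Finset.card_le_card fun b => ?_)⟩
        · have := h1 b
          by_cases hb : σ b <;> simpa [swapAt, hb] using this
        · simp only [Finset.mem_filter, Finset.mem_univ, true_and]
          by_cases hb : σ b <;> simp [swapAt, hb]
      · refine (Finset.card_biUnion_le_card_mul _ _ (2 ^ q) fun τ _ => card_swaps_le _ _).trans ?_
        rw [← Set.ncard_eq_toFinset_card R hRfin]
        exact Nat.mul_le_mul_right _ (htr z)
    exact_mod_cast hle
  have hsum : ∑ σ : Fin (2 * q) → Bool, μ (swapAt σ ⁻¹' ghostEvent A q) ≤ G * 2 ^ q := by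
    have h1 : ∀ σ : Fin (2 * q) → Bool, μ (swapAt σ ⁻¹' ghostEvent A q) =
        ∫⁻ z, (swapAt σ ⁻¹' ghostEvent A q).indicator (fun _ => (1 : ENNReal)) z ∂μ :=
      fun σ => (lintegral_indicator_one₀ (hnull' σ)).symm
    simp only [h1]
    rw [← lintegral_finsetSum' _ fun σ _ => (aemeasurable_const.indicator₀ (hnull' σ))]
    calc _ ≤ ∫⁻ _, (G * 2 ^ q : ENNReal) ∂μ := lintegral_mono hcount
      _ = _ := by simp
  have h1 : ∀ σ : Fin (2 * q) → Bool, μ (swapAt σ ⁻¹' ghostEvent A q) = μ (ghostEvent A q) :=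
    fun σ => (measurePreserving_swapAt P σ).measure_preimage hnull
  simp only [h1, Finset.sum_const,
    Finset.card_univ, Fintype.card_fun, Fintype.card_bool, Fintype.card_fin, nsmul_eq_mul] at hsum
  have h2 : (2 : ENNReal) ^ q ≠ 0 := by positivity
  refine (ENNReal.mul_le_mul_iff_left h2 (by finiteness)).1 ?_
  refine le_trans (le_of_eq ?_) hsum
  push_cast
  ring

end Symmetrization

/-! ### Growth function and measurability -/

section VC

variable {X : Type*} {H : Set (X → Bool)} {d : ℕ}

theorem Shatters.card_le (hd : vcDim H ≤ d) {s : Finset X} (hs : Shatters H s) : s.card ≤ d := by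
  have h : (s.card : ℕ∞) ≤ vcDim H :=
    le_iSup₂ (f := fun (s : Finset X) (_ : Shatters H s) => (s.card : ℕ∞)) s hs
  exact_mod_cast h.trans hd

/-- The Sauer–Shelah lemma for the labelings of a family of points, which may have repetitions. -/
theorem ncard_labelings_le (hd : vcDim H ≤ d) {J : Type*} [Fintype J] (x : J → X) :
    (Set.range fun (h : H) (j : J) => (h : X → Bool) (x j)).ncard ≤ (Fintype.card J + 1) ^ d := by
  classical
  set R := Set.range fun (h : H) (j : J) => (h : X → Bool) (x j) with hR
  have hRfin : R.Finite := Set.toFinite _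
  set 𝒜 : Finset (Finset J) := hRfin.toFinset.image fun v => Finset.univ.filter fun j => v j = true
  have hmem : ∀ u ∈ 𝒜, ∃ h ∈ H, ∀ j, h (x j) = true ↔ j ∈ u := by
    intro u hu
    obtain ⟨v, hv, rfl⟩ := Finset.mem_image.1 hu
    obtain ⟨h, rfl⟩ := hRfin.mem_toFinset.1 hv
    exact ⟨h, h.2, fun j => by simp⟩
  have hcard : R.ncard = 𝒜.card := by
    rw [Finset.card_image_of_injective, Set.ncard_eq_toFinset_card R hRfin]
    intro v w hvw
    ext j
    have := Finset.ext_iff.1 hvw j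
    simp only [Finset.mem_filter, Finset.mem_univ, true_and] at this
    exact Bool.eq_iff_iff.2 this ▸ rfl
  have hvc : 𝒜.vcDim ≤ d := by
    refine Finset.sup_le fun S hS => ?_
    rw [Finset.mem_shatterer] at hS
    -- two equal points cannot be labelled differently
    have hinj : Set.InjOn x S := by
      intro j hj j' hj' hx
      by_contra hne
      obtain ⟨u, hu, hSu⟩ := hS (t := {j}) (by simpa using hj)
      obtain ⟨h, -, hh⟩ := hmem u hu
      have h1 : j ∈ S ∩ u := by rw [hSu]; simp
      have h2 : j' ∉ S ∩ u := by rw [hSu]; simpa using Ne.symm hne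
      have h3 : j' ∉ u := fun h => h2 (Finset.mem_inter.2 ⟨hj', h⟩)
      exact h3 ((hh j').1 (hx ▸ (hh j).2 (Finset.mem_inter.1 h1).2))
    rw [← Finset.card_image_of_injOn hinj]
    refine Shatters.card_le hd fun b => ?_
    obtain ⟨u, hu, hSu⟩ := hS (t := S.filter fun j => b (x j) = true) (Finset.filter_subset _ _)
    obtain ⟨h, hH, hh⟩ := hmem u hu
    refine ⟨h, hH, fun y hy => ?_⟩
    obtain ⟨j, hj, rfl⟩ := Finset.mem_image.1 hy
    have h1 := Finset.ext_iff.1 hSu j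
    simp only [Finset.mem_inter, Finset.mem_filter, hj, true_and] at h1
    rw [Bool.eq_iff_iff, hh j, h1]
  rw [hcard]
  calc 𝒜.card ≤ ∑ i ∈ Finset.Iic 𝒜.vcDim, (Fintype.card J).choose i :=
        (Finset.card_le_card_shatterer 𝒜).trans Finset.card_shatterer_le_sum_vcDim
    _ ≤ ∑ i ∈ Finset.range (d + 1), (Fintype.card J).choose i := by
        refine Finset.sum_le_sum_of_subset fun i hi => ?_
        rw [Finset.mem_Iic] at hi
        exact Finset.mem_range.2 (by omega)
    _ ≤ ∑ i ∈ Finset.range (d + 1), Fintype.card J ^ i * 1 ^ (d - i) * d.choose i := by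
        refine Finset.sum_le_sum fun i hi => ?_
        rw [one_pow, mul_one]
        exact (Nat.choose_le_pow _ _).trans
          (Nat.le_mul_of_pos_right _ (Nat.choose_pos (Nat.lt_succ_iff.1 (Finset.mem_range.1 hi))))
    _ = (Fintype.card J + 1) ^ d := (add_pow _ _ _).symm

/-- An infinite class has positive VC dimension. -/
theorem one_le_of_vcDim_le (hd : vcDim H ≤ d) (hH : H.Infinite) : 1 ≤ d := by
  by_contra hd0
  obtain rfl : d = 0 := by omega
  refine hH (Set.Subsingleton.finite fun h₁ hh₁ h₂ hh₂ => ?_)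
  by_contra hne
  obtain ⟨x, hx⟩ := Function.ne_iff.1 hne
  have : Shatters H {x} := by
    intro b
    rcases eq_or_ne (h₁ x) (b x) with h | h
    · exact ⟨h₁, hh₁, by simpa using h⟩
    · refine ⟨h₂, hh₂, ?_⟩
      simp only [Finset.mem_singleton, forall_eq]
      cases hb : b x <;> cases h1 : h₁ x <;> cases h2 : h₂ x <;> simp_all
  simpa using Shatters.card_le hd this

variable [MeasurableSpace X]

theorem Admissible.measurable (hH : Admissible H) {h : X → Bool} (hh : h ∈ H) : Measurable h := by
  obtain ⟨σ, hσ, -⟩ := hH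
  exact hσ.comp (measurable_id.prodMk (measurable_const (a := (⟨h, hh⟩ : H))))

theorem Admissible.measurableSet_dis (hH : Admissible H) :
    ∀ h₁ ∈ H, ∀ h₂ ∈ H, MeasurableSet (dis h₁ h₂) := fun _ h1 _ h2 =>
  (measurableSet_eq_fun (hH.measurable h1) (hH.measurable h2)).compl

/-- Events which assert that some hypothesis of the class realizes one of finitely many patterns
on measurably chosen points are null measurable. -/
theorem Admissible.nullMeasurableSet_exists (hH : Admissible H) {Z J : Type*} [MeasurableSpace Z]
    [Fintype J] (μ : Measure Z) [IsProbabilityMeasure μ] {x : Z → J → X} (hx : Measurable x)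
    {g : X → Bool} (hg : Measurable g) (W : Set (J → Bool × Bool)) :
    NullMeasurableSet {z | ∃ h : H, (fun j => ((h : X → Bool) (x z j), g (x z j))) ∈ W} μ := by
  obtain ⟨σ, hσ, hproj⟩ := hH
  let e := Fintype.equivFin J
  let F : (Fin (Fintype.card J) → X) × H → J → Bool × Bool := fun p j =>
    ((p.2 : X → Bool) (p.1 (e j)), g (p.1 (e j)))
  have hF : Measurable F := by
    refine measurable_pi_lambda _ fun j => ?_
    have h1 : Measurable fun p : (Fin (Fintype.card J) → X) × H => p.1 (e j) :=
      (measurable_pi_apply _).comp measurable_fst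
    exact (hσ.comp (h1.prodMk measurable_snd)).prodMk (hg.comp h1)
  have hx' : Measurable fun (z : Z) (i : Fin (Fintype.card J)) => x z (e.symm i) :=
    measurable_pi_lambda _ fun i => (measurable_pi_apply _).comp hx
  have : IsProbabilityMeasure (μ.map fun z i => x z (e.symm i)) :=
    Measure.isProbabilityMeasure_map hx'.aemeasurable
  have hnull := hproj _ (F ⁻¹' W) (hF (Set.toFinite W).measurableSet)
    (μ.map fun z i => x z (e.symm i)) this
  have hpre := hnull.preimage (f := fun z i => x z (e.symm i)) (μa := μ)
    ⟨hx', Measure.AbsolutelyContinuous.rfl⟩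
  convert hpre using 1
  ext z
  simp [F]

end VC

/-! ### Consistent hypotheses over a class of finite VC dimension -/

section Generalization

variable {X : Type*} [MeasurableSpace X] {H : Set (X → Bool)} {d k : ℕ} {D : Fin k → Measure X}
  [∀ i, IsProbabilityMeasure (D i)]

/-- An `ε`-net theorem in which the single examples are samples of shape `m`: if such a sample
distinguishes any two far apart hypotheses with probability at least `3 / 4`, then `2 q`
independent ones suffice for all hypotheses at once. -/
theorem pacFeasible_of_blocks (hH : Admissible H) (hd : vcDim H ≤ d) {ε δ : ℝ} (hδ : 0 ≤ δ)
    {m n : Fin k → ℕ} {q : ℕ} (hmn : ∀ i, 2 * q * m i ≤ n i)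
    (hblock : ∀ h₁ ∈ H, ∀ h₂ ∈ H, FarApart D ε h₁ h₂ →
      ∏ i, (1 - D i (dis h₁ h₂)) ^ m i ≤ 1 / 4)
    (hcount : 2 * (((2 * q + 2 * q) * ∑ i, m i + 1 : ℕ) : ℝ) ^ d ≤ δ * 2 ^ q) :
    PACFeasible H D ε δ n := by
  classical
  intro i
  refine requirement_of_measure_le hδ fun hstar hs => ?_
  let A : H → Set (Sample X m) := fun h => {U | ∀ i j, U i j ∉ dis (h : X → Bool) hstar}ᶜ
  let I : Set H := {h | ENNReal.ofReal ε < D i (dis (h : X → Bool) hstar)}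
  have hdis : ∀ h : H, MeasurableSet (dis (h : X → Bool) hstar) :=
    fun h => hH.measurableSet_dis h h.2 hstar hs
  have hA : ∀ h ∈ I, MeasurableSet (A h) := fun h _ => (measurableSet_avoid (hdis h)).compl
  have hP : ∀ h ∈ I, sampleLaw D m (A h)ᶜ ≤ 1 / 4 := by
    intro h hI
    rw [compl_compl, sampleLaw_avoid m (hdis h)]
    exact hblock h h.2 hstar hs ⟨i, hI⟩
  let J := (Fin (2 * q) ⊕ Fin (2 * q)) × (i : Fin k) × Fin (m i)
  let pts : (Fin (2 * q) → Sample X m) × (Fin (2 * q) → Sample X m) → J → X := fun z p =>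
    (Sum.elim z.1 z.2 p.1) p.2.1 p.2.2
  have hpts : Measurable pts := by
    refine measurable_pi_lambda _ ?_
    rintro ⟨b | b, i, j⟩
    · exact (measurable_sample_eval i j).comp ((measurable_pi_apply b).comp measurable_fst)
    · exact (measurable_sample_eval i j).comp ((measurable_pi_apply b).comp measurable_snd)
  have hcardJ : Fintype.card J = (2 * q + 2 * q) * ∑ i, m i := by
    simp [J]
  set G := (Fintype.card J + 1) ^ d with hG
  have htr : ∀ z : (Fin (2 * q) → Sample X m) × (Fin (2 * q) → Sample X m),
      (Set.range fun h => (({b | z.1 b ∈ A h}, {b | z.2 b ∈ A h}) :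
        Set (Fin (2 * q)) × Set (Fin (2 * q)))).ncard ≤ G := by
    intro z
    refine le_trans ?_ (ncard_labelings_le hd (pts z))
    let F : (J → Bool) → Set (Fin (2 * q)) × Set (Fin (2 * q)) := fun v =>
      ({b | ¬ ∀ i j, v (Sum.inl b, ⟨i, j⟩) = hstar (z.1 b i j)},
        {b | ¬ ∀ i j, v (Sum.inr b, ⟨i, j⟩) = hstar (z.2 b i j)})
    refine le_trans (Set.ncard_le_ncard (t := F '' Set.range fun (h : H) (j : J) =>
      (h : X → Bool) (pts z j)) ?_ (Set.toFinite _)) (Set.ncard_image_le (Set.toFinite _))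
    rintro _ ⟨h, rfl⟩
    refine ⟨_, ⟨h, rfl⟩, ?_⟩
    simp [F, A, pts, dis]
  have hnull : NullMeasurableSet (ghostEvent A q) ((Measure.pi fun _ : Fin (2 * q) =>
      sampleLaw D m).prod (Measure.pi fun _ => sampleLaw D m)) := by
    convert hH.nullMeasurableSet_exists ((Measure.pi fun _ : Fin (2 * q) =>
      sampleLaw D m).prod (Measure.pi fun _ : Fin (2 * q) => sampleLaw D m)) hpts (hH.measurable hs)
      {v : J → Bool × Bool | (∀ b i j, (v (Sum.inl b, ⟨i, j⟩)).1 = (v (Sum.inl b, ⟨i, j⟩)).2) ∧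
        q ≤ (Finset.univ.filter fun b => ¬ ∀ i j,
          (v (Sum.inr b, ⟨i, j⟩)).1 = (v (Sum.inr b, ⟨i, j⟩)).2).card} using 1
    ext z
    refine exists_congr fun h => ?_
    simp only [A, pts, dis, Set.mem_ofPred_eq, Set.mem_compl_iff, ne_eq, not_not, Sum.elim_inl,
      Sum.elim_inr]
    exact and_congr Iff.rfl (by congr!)
  have hghost := pi_exists_avoid_le_ghostEvent (q := q) hA hP
  have hswap := ghostEvent_mul_le htr hnull
  have hpre := measurePreserving_blocks (D := D) (B := Fin (2 * q)) (m := m) (n := n)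
    fun i => finProdFinEquiv.toEmbedding.trans (Fin.castLEEmb (hmn i))
  have hle : sampleLaw D n {U | ∃ h ∈ H, ENNReal.ofReal ε < D i (dis h hstar) ∧
      ∀ i j, U i j ∉ dis h hstar} ≤ Measure.pi (fun _ : Fin (2 * q) => sampleLaw D m)
        {x | ∃ h ∈ I, ∀ b, x b ∉ A h} := by
    rw [← hpre.map_eq]
    refine le_trans (measure_mono ?_) (Measure.le_map_apply hpre.measurable.aemeasurable _)
    rintro U ⟨h, hh, hfar, hU⟩
    refine ⟨⟨h, hh⟩, hfar, fun b => ?_⟩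
    simp only [A, Set.mem_compl_iff, not_not]
    exact fun i j => hU _ _
  refine hle.trans (hghost.trans ?_)
  have h2 : (2 : ENNReal) ^ q ≠ 0 := by positivity
  refine (ENNReal.mul_le_mul_iff_left h2 (by finiteness)).1 ?_
  rw [mul_assoc]
  calc _ ≤ 2 * (G : ENNReal) := by gcongr
    _ = ENNReal.ofReal (2 * (((2 * q + 2 * q) * ∑ i, m i + 1 : ℕ) : ℝ) ^ d) := by
        rw [hG, hcardJ, ENNReal.ofReal_mul (by norm_num), ENNReal.ofReal_pow (by positivity),
          ENNReal.ofReal_natCast]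
        push_cast; simp
    _ ≤ ENNReal.ofReal (δ * 2 ^ q) := ENNReal.ofReal_le_ofReal hcount
    _ = _ := by
        rw [ENNReal.ofReal_mul hδ, ENNReal.ofReal_pow (by norm_num)]; simp

end Generalization

/-! ### Covers and packings -/

section Covers

variable {X Y : Type*} [MeasurableSpace X] {k : ℕ} {D : Fin k → Measure X}
  [∀ i, IsProbabilityMeasure (D i)]

/-- Replacing two hypotheses by nearby ones hardly changes the probability that a sample of shape
`m` fails to distinguish them. -/
theorem prod_avoid_le_of_close {h₁ h₂ g₁ g₂ : X → Y} (hh : MeasurableSet (dis h₁ h₂))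
    (hg : MeasurableSet (dis g₁ g₂)) (h1 : MeasurableSet (dis h₁ g₁))
    (h2 : MeasurableSet (dis h₂ g₂)) {r : ENNReal} (hr1 : ∀ i, D i (dis h₁ g₁) ≤ r)
    (hr2 : ∀ i, D i (dis h₂ g₂) ≤ r) (m : Fin k → ℕ) :
    ∏ i, (1 - D i (dis h₁ h₂)) ^ m i ≤
      ∏ i, (1 - D i (dis g₁ g₂)) ^ m i + ((∑ i, m i : ℕ) : ENNReal) * (2 * r) := by
  rw [← sampleLaw_avoid m hh, ← sampleLaw_avoid m hg]
  have hsub : {U : Sample X m | ∀ i j, U i j ∉ dis h₁ h₂} ⊆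
      {U | ∀ i j, U i j ∉ dis g₁ g₂} ∪
        ⋃ p : (i : Fin k) × Fin (m i), {U | U p.1 p.2 ∈ dis h₁ g₁ ∪ dis h₂ g₂} := by
    intro U hU
    by_contra hcon
    simp only [Set.mem_union, Set.mem_iUnion, Set.mem_ofPred_eq, not_or, not_exists] at hcon
    obtain ⟨h3, h4⟩ := hcon
    refine h3 fun i j hij => ?_
    have h5 := h4 ⟨i, j⟩
    have h6 := hU i j
    simp only [dis, Set.mem_ofPred_eq, ne_eq, not_not] at hij h5 h6
    exact hij (h5.1.symm.trans (h6.trans h5.2))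
  refine (measure_mono hsub).trans ((measure_union_le _ _).trans (add_le_add_right ?_ _))
  refine (measure_iUnion_fintype_le _ _).trans ?_
  calc _ ≤ ∑ _p : (i : Fin k) × Fin (m i), 2 * r := by
        refine Finset.sum_le_sum fun p _ => ?_
        rw [sampleLaw_eval m p.1 p.2 (h1.union h2), two_mul]
        exact (measure_union_le _ _).trans (add_le_add (hr1 _) (hr2 _))
    _ = _ := by simp

variable {H : Set (X → Bool)} {d : ℕ}

/-- A sample which distinguishes all pairs of a separated set embeds that set into the labelings of
the sample. -/
theorem card_le_of_separated (hmeas : ∀ h₁ ∈ H, ∀ h₂ ∈ H, MeasurableSet (dis h₁ h₂))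
    (hd : vcDim H ≤ d) {ρ : ℝ} (hρ : 0 ≤ ρ) {P : Finset (X → Bool)} (hP : ↑P ⊆ H)
    (hsep : ∀ h₁ ∈ P, ∀ h₂ ∈ P, h₁ ≠ h₂ → FarApart D ρ h₁ h₂) {n : ℕ}
    (hn : (P.card : ℝ) ^ 2 * Real.exp (-(ρ * n)) < 1) : P.card ≤ (k * n + 1) ^ d := by
  classical
  let m : Fin k → ℕ := fun _ => n
  have hpair : ∀ p ∈ P.offDiag, sampleLaw D m {U | ∀ i j, U i j ∉ dis p.1 p.2} ≤
      ENNReal.ofReal (Real.exp (-(ρ * n))) := by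
    intro p hp
    obtain ⟨hp1, hp2, hne⟩ := Finset.mem_offDiag.1 hp
    rw [sampleLaw_avoid m (hmeas _ (hP hp1) _ (hP hp2))]
    -- Equal contributions solve the program over `P` with `η = |P| * exp (-ρ n)`.
    have hpos : (0 : ℝ) < (P : Set (X → Bool)).ncard := by
      rw [Set.ncard_coe_finset]
      exact_mod_cast Finset.card_pos.2 ⟨_, hp1⟩
    have hc : LPFeasible (P : Set (X → Bool)) D ρ
        ((P : Set (X → Bool)).ncard * Real.exp (-(ρ * n))) (fun i => (m i : ℝ)) :=
      lpFeasible_const hρ fun _ => by rw [mul_div_cancel_left₀ _ hpos.ne']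
    have := lpFeasible_natCast_iff.1 hc p.1 hp1 p.2 hp2 (hsep _ hp1 _ hp2 hne)
    rwa [mul_div_cancel_left₀ _ hpos.ne'] at this
  obtain ⟨U, hU⟩ : ∃ U : Sample X m, ∀ p ∈ P.offDiag, ∃ i j, U i j ∈ dis p.1 p.2 := by
    by_contra! hcon
    have huniv : (Set.univ : Set (Sample X m)) ⊆
        ⋃ p ∈ P.offDiag, {U | ∀ i j, U i j ∉ dis p.1 p.2} := by
      intro U _
      obtain ⟨p, hp, hU⟩ := hcon U
      exact Set.mem_biUnion (show p ∈ (P.offDiag : Set _) from hp) hU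
    have h1 : (1 : ENNReal) ≤ ∑ _p ∈ P.offDiag, ENNReal.ofReal (Real.exp (-(ρ * n))) := by
      rw [← measure_univ (μ := sampleLaw D m)]
      exact (measure_mono huniv).trans ((measure_biUnion_finset_le _ _).trans
        (Finset.sum_le_sum hpair))
    rw [Finset.sum_const, nsmul_eq_mul, ← ENNReal.ofReal_natCast,
      ← ENNReal.ofReal_mul (Nat.cast_nonneg _), ENNReal.one_le_ofReal] at h1
    have h2 : (P.offDiag.card : ℝ) ≤ (P.card : ℝ) ^ 2 := by
      rw [Finset.offDiag_card, pow_two]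
      exact_mod_cast Nat.sub_le _ _
    have := mul_le_mul_of_nonneg_right h2 (Real.exp_pos (-(ρ * n))).le
    linarith
  let x : (i : Fin k) × Fin (m i) → X := fun p => U p.1 p.2
  have hlab := ncard_labelings_le hd x
  have hcardJ : Fintype.card ((i : Fin k) × Fin (m i)) = k * n := by simp [m]
  rw [hcardJ] at hlab
  refine le_trans ?_ hlab
  rw [← Set.ncard_coe_finset P]
  refine Set.ncard_le_ncard_of_injOn (fun h p => h (x p)) (fun h hh => ⟨⟨h, hP hh⟩, rfl⟩) ?_
    (Set.toFinite _)
  intro h₁ hh₁ h₂ hh₂ heq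
  by_contra hne
  obtain ⟨i, j, hij⟩ := hU (h₁, h₂) (Finset.mem_offDiag.2 ⟨hh₁, hh₂, hne⟩)
  exact hij (congrFun heq ⟨i, j⟩)

/-- The packing bound in closed form: the inequality of `card_le_of_separated` is solved for the
cardinality with the help of `log y ≤ y - 1`. -/
theorem card_le_rpow_of_separated (hmeas : ∀ h₁ ∈ H, ∀ h₂ ∈ H, MeasurableSet (dis h₁ h₂))
    (hd : vcDim H ≤ d) (hd1 : 1 ≤ d) (hk : 1 ≤ k) {ρ : ℝ} (hρ : 0 < ρ) (hρ1 : ρ ≤ 1)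
    {P : Finset (X → Bool)} (hP : ↑P ⊆ H)
    (hsep : ∀ h₁ ∈ P, ∀ h₂ ∈ P, h₁ ≠ h₂ → FarApart D ρ h₁ h₂) :
    (P.card : ℝ) ≤ (6 * k * d / ρ) ^ (2 * d) := by
  have hk' : (1 : ℝ) ≤ k := by exact_mod_cast hk
  have hd' : (1 : ℝ) ≤ d := by exact_mod_cast hd1
  rcases Nat.eq_zero_or_pos P.card with h0 | hpos
  · rw [h0, Nat.cast_zero]; positivity
  set N : ℝ := (P.card : ℝ) with hN
  have hN1 : 1 ≤ N := by rw [hN]; exact_mod_cast hpos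
  set n := ⌈(2 * Real.log N + 1) / ρ⌉₊ with hn
  have hlogN : 0 ≤ Real.log N := Real.log_nonneg hN1
  have hn1 : 2 * Real.log N + 1 ≤ ρ * n := by
    rw [← div_le_iff₀' hρ]; exact Nat.le_ceil _
  have hn2 : (n : ℝ) ≤ (2 * Real.log N + 1) / ρ + 1 :=
    (Nat.ceil_lt_add_one (by positivity)).le
  have hexp : N ^ 2 * Real.exp (-(ρ * n)) < 1 := by
    have h1 : N ^ 2 = Real.exp (2 * Real.log N) := by
      rw [two_mul, Real.exp_add, Real.exp_log (by linarith), pow_two]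
    rw [h1, ← Real.exp_add, Real.exp_lt_one_iff]
    linarith
  have hcard : N ≤ (k * n + 1 : ℝ) ^ d := by
    have := card_le_of_separated hmeas hd hρ.le hP hsep (n := n) hexp
    rw [hN]
    exact_mod_cast this
  -- `log N = 2 d log y ≤ 2 d (y - 1)`, so that `N = y ^ (2 d) ≤ (6 k d / ρ) ^ d * y ^ d`
  set y := N ^ (1 / (2 * d : ℝ)) with hy
  have hy1 : 1 ≤ y := Real.one_le_rpow hN1 (by positivity)
  have hyN : y ^ (2 * d) = N := by
    rw [hy, ← Real.rpow_natCast, ← Real.rpow_mul (by linarith)]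
    push_cast
    rw [one_div_mul_cancel (by positivity), Real.rpow_one]
  have hlog : Real.log N ≤ 2 * d * (y - 1) := by
    rw [← hyN, Real.log_pow]
    push_cast
    exact mul_le_mul_of_nonneg_left (Real.log_le_sub_one_of_pos (by linarith)) (by positivity)
  have hbase : (k * n + 1 : ℝ) ≤ 6 * k * d / ρ * y := by
    have h1 : (n : ℝ) ≤ 4 * d * y / ρ + 1 := by
      refine hn2.trans ?_
      gcongr
      nlinarith
    have h2 : (1 : ℝ) ≤ d * y / ρ := by
      rw [le_div_iff₀ hρ]; nlinarith
    have h3 : 6 * k * d / ρ * y = k * (4 * (d * y / ρ) + (d * y / ρ)) + k * (d * y / ρ) := by ring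
    have h4 : 4 * d * y / ρ = 4 * (d * y / ρ) := by ring
    rw [h3]
    rw [h4] at h1
    have h5 : (k : ℝ) * n ≤ k * (4 * (d * y / ρ) + d * y / ρ) := by gcongr; linarith
    have h6 : (1 : ℝ) ≤ k * (d * y / ρ) := one_le_mul_of_one_le_of_one_le hk' h2
    linarith
  have hB0 : (0 : ℝ) ≤ 6 * k * d / ρ := by positivity
  have h1 : y ^ d * y ^ d ≤ (6 * k * d / ρ) ^ d * y ^ d := by
    rw [← pow_add, ← two_mul, hyN, ← mul_pow]
    exact hcard.trans (pow_le_pow_left₀ (by positivity) hbase d)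
  have h2 : y ^ d ≤ (6 * k * d / ρ) ^ d := le_of_mul_le_mul_right h1 (by positivity)
  rw [← hyN, mul_comm 2 d, pow_mul, pow_mul]
  exact pow_le_pow_left₀ (by positivity) h2 2

/-- A maximal separated set is a cover. -/
theorem exists_finite_cover (hmeas : ∀ h₁ ∈ H, ∀ h₂ ∈ H, MeasurableSet (dis h₁ h₂))
    (hd : vcDim H ≤ d) (hd1 : 1 ≤ d) (hk : 1 ≤ k) {ρ : ℝ} (hρ : 0 < ρ) (hρ1 : ρ ≤ 1) :
    ∃ P : Finset (X → Bool), IsCover H D ρ ↑P ∧ (P.card : ℝ) ≤ (6 * k * d / ρ) ^ (2 * d) := by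
  classical
  set S : Set ℕ := {n | ∃ P : Finset (X → Bool), ↑P ⊆ H ∧
    (∀ h₁ ∈ P, ∀ h₂ ∈ P, h₁ ≠ h₂ → FarApart D ρ h₁ h₂) ∧ P.card = n}
  have hbdd : BddAbove S := by
    refine ⟨⌊(6 * k * d / ρ : ℝ) ^ (2 * d)⌋₊, ?_⟩
    rintro n ⟨P, hP, hsep, rfl⟩
    exact Nat.le_floor (card_le_rpow_of_separated hmeas hd hd1 hk hρ hρ1 hP hsep)
  obtain ⟨P, hP, hsep, hcard⟩ := Nat.sSup_mem (s := S) ⟨0, ∅, by simp⟩ hbdd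
  refine ⟨P, ⟨hP, fun h hh => ?_⟩, card_le_rpow_of_separated hmeas hd hd1 hk hρ hρ1 hP hsep⟩
  by_contra! hcon
  have hnot : h ∉ P := by
    intro hmem
    obtain ⟨i, hi⟩ := hcon h hmem
    simp [dis] at hi
  have hlt : P.card + 1 ≤ sSup S := by
    refine le_csSup hbdd ⟨insert h P, ?_, ?_, Finset.card_insert_of_notMem hnot⟩
    · rw [Finset.coe_insert]
      exact Set.insert_subset hh hP
    · intro h₁ hh₁ h₂ hh₂ hne
      rw [Finset.mem_insert] at hh₁ hh₂
      rcases hh₁ with rfl | hh₁ <;> rcases hh₂ with rfl | hh₂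
      · exact absurd rfl hne
      · exact hcon _ hh₂
      · rw [FarApart, dis_comm]; exact hcon _ hh₁
      · exact hsep _ hh₁ _ hh₂ hne
  omega

/-- A finite subclass which approximates not only the hypotheses but also the far apart pairs of
hypotheses by far apart pairs. -/
theorem exists_finite_pair_cover (hmeas : ∀ h₁ ∈ H, ∀ h₂ ∈ H, MeasurableSet (dis h₁ h₂))
    (hd : vcDim H ≤ d) (hd1 : 1 ≤ d) (hk : 1 ≤ k) {ρ : ℝ} (hρ : 0 < ρ) (hρ1 : ρ ≤ 1) (ε : ℝ) :
    ∃ T : Set (X → Bool), T.Finite ∧ IsCover H D ρ T ∧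
      (T.ncard : ℝ) ≤ 3 * (6 * k * d / ρ) ^ (4 * d) ∧
      ∀ h₁ ∈ H, ∀ h₂ ∈ H, FarApart D ε h₁ h₂ → ∃ g₁ ∈ T, ∃ g₂ ∈ T, FarApart D ε g₁ g₂ ∧
        (∀ i, D i (dis h₁ g₁) ≤ ENNReal.ofReal (2 * ρ)) ∧
        (∀ i, D i (dis h₂ g₂) ≤ ENNReal.ofReal (2 * ρ)) := by
  classical
  obtain ⟨P, ⟨hPH, hcov⟩, hcard⟩ := exists_finite_cover (D := D) hmeas hd hd1 hk hρ hρ1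
  choose! f hfP hf using hcov
  -- `B'` holds one far apart pair for each pair of centers that some far apart pair is assigned to.
  set B : Set ((X → Bool) × (X → Bool)) := {p | p.1 ∈ H ∧ p.2 ∈ H ∧ FarApart D ε p.1 p.2}
  set g : (X → Bool) × (X → Bool) → (X → Bool) × (X → Bool) := fun p => (f p.1, f p.2)
  obtain ⟨B', hB', hbij⟩ := B.exists_subset_bijOn g
  have himg : g '' B ⊆ ↑(P ×ˢ P) := by
    rintro _ ⟨p, hp, rfl⟩
    exact Finset.mem_coe.2 (Finset.mem_product.2 ⟨hfP _ hp.1, hfP _ hp.2.1⟩)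
  have himgfin : (g '' B).Finite := (Finset.finite_toSet _).subset himg
  have hB'fin : B'.Finite := by
    refine Set.Finite.of_finite_image ?_ hbij.injOn
    rwa [hbij.image_eq]
  have hB'card : B'.ncard ≤ P.card * P.card := by
    rw [← hbij.injOn.ncard_image, hbij.image_eq, ← Finset.card_product,
      ← Set.ncard_coe_finset]
    exact Set.ncard_le_ncard himg (Finset.finite_toSet _)
  have htri : ∀ {h h' : X → Bool}, h ∈ H → h' ∈ H → f h' = f h → ∀ i,
      D i (dis h h') ≤ ENNReal.ofReal (2 * ρ) := by
    intro h h' hh hh' heq i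
    rw [two_mul, ENNReal.ofReal_add hρ.le hρ.le]
    refine (measure_mono (dis_subset_union h (f h) h')).trans ((measure_union_le _ _).trans ?_)
    refine add_le_add (hf h hh i) ?_
    rw [← heq, dis_comm]
    exact hf h' hh' i
  refine ⟨↑P ∪ (Prod.fst '' B' ∪ Prod.snd '' B'),
    (Finset.finite_toSet P).union ((hB'fin.image _).union (hB'fin.image _)), ⟨?_, ?_⟩, ?_, ?_⟩
  · refine Set.union_subset hPH (Set.union_subset ?_ ?_)
    · rintro _ ⟨p, hp, rfl⟩; exact (hB' hp).1
    · rintro _ ⟨p, hp, rfl⟩; exact (hB' hp).2.1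
  · exact fun h hh => ⟨f h, Or.inl (hfP h hh), hf h hh⟩
  · have h1 : (↑P ∪ (Prod.fst '' B' ∪ Prod.snd '' B')).ncard ≤
        P.card + (P.card * P.card + P.card * P.card) := by
      refine (Set.ncard_union_le _ _).trans (add_le_add (Set.ncard_coe_finset P).le ?_)
      exact (Set.ncard_union_le _ _).trans (add_le_add
        ((Set.ncard_image_le hB'fin).trans hB'card) ((Set.ncard_image_le hB'fin).trans hB'card))
    have h1' : ((↑P ∪ (Prod.fst '' B' ∪ Prod.snd '' B')).ncard : ℝ) ≤
        P.card + (P.card * P.card + P.card * P.card) := by exact_mod_cast h1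
    set Q : ℝ := (6 * k * d / ρ) ^ (2 * d)
    have hQ : 1 ≤ Q := by
      refine one_le_pow₀ ?_
      have hk' : (1 : ℝ) ≤ k := by exact_mod_cast hk
      have hd' : (1 : ℝ) ≤ d := by exact_mod_cast hd1
      rw [le_div_iff₀ hρ]
      nlinarith
    have hQ2 : (6 * k * d / ρ) ^ (4 * d) = Q * Q := by
      rw [← pow_add]; congr 1; ring
    rw [hQ2]
    have hc0 : (0 : ℝ) ≤ P.card := Nat.cast_nonneg _
    nlinarith [mul_le_mul hcard hcard hc0 (by linarith)]
  · intro h₁ hh₁ h₂ hh₂ hfar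
    have hmem : g (h₁, h₂) ∈ g '' B := ⟨_, ⟨hh₁, hh₂, hfar⟩, rfl⟩
    rw [← hbij.image_eq] at hmem
    obtain ⟨p, hp, hgp⟩ := hmem
    obtain ⟨hp1, hp2, hpfar⟩ := hB' hp
    simp only [g, Prod.mk.injEq] at hgp
    exact ⟨p.1, Or.inr (Or.inl ⟨p, hp, rfl⟩), p.2, Or.inr (Or.inr ⟨p, hp, rfl⟩), hpfar,
      htri hh₁ hp1 hgp.1, htri hh₂ hp2 hgp.2⟩

end Covers

/-! ### Size estimates for the parameters -/

section Parameters

variable {k d N Q : ℕ} {c : Fin k → ℝ} {ε δ : ℝ}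

theorem cMin_le (c : Fin k → ℝ) (i : Fin k) : cMin c ≤ c i :=
  ciInf_le (Set.finite_range c).bddBelow i

theorem le_cMax (c : Fin k → ℝ) (i : Fin k) : c i ≤ cMax c :=
  le_ciSup (Set.finite_range c).bddAbove i

theorem cMin_pos (hk : 0 < k) (hc : ∀ i, 0 < c i) : 0 < cMin c := by
  have : Nonempty (Fin k) := ⟨⟨0, hk⟩⟩
  obtain ⟨i, hi⟩ := exists_eq_ciInf_of_finite (f := c)
  rw [cMin, ← hi]
  exact hc i

/-- The quotient `a * k / γ` of the cover radius `γ`. All parameters are bounded by it, and it is at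
most the third power of `logArg`. -/
noncomputable def complexity (c : Fin k → ℝ) (d : ℕ) (ε δ : ℝ) : ℝ :=
  cMax c * (k : ℝ) ^ 2 * ((d : ℝ) + Real.log (1 / δ)) / (cMin c * ε * δ)

theorem radius_eq (a : ℝ) (hk : 0 < k) :
    radius a c d ε δ = a * k / complexity c d ε δ := by
  have hk' : (k : ℝ) ≠ 0 := by exact_mod_cast hk.ne'
  unfold radius complexity
  rw [mul_div_assoc a, div_div_eq_mul_div]
  congr 1
  rw [pow_two, show cMax c * ((k : ℝ) * k) * (d + Real.log (1 / δ)) =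
    (cMax c * k * (d + Real.log (1 / δ))) * k by ring]
  rw [mul_comm (k : ℝ) (cMin c * ε * δ), mul_div_mul_right _ _ hk']

/-- The inequalities between the parameters, in terms of `L = logArg`. -/
theorem parameter_bounds (hk : 0 < k) (hc : ∀ i, 0 < c i) (hd : 1 ≤ d) (hε : 0 < ε) (hε1 : ε < 1)
    (hδ : 0 < δ) (hδ1 : δ < 1) :
    (k : ℝ) ≤ logArg c d ε δ ∧ (d : ℝ) ≤ logArg c d ε δ ∧ 1 / δ ≤ logArg c d ε δ ∧
      cMax c * k * d / (cMin c * ε) ≤ logArg c d ε δ ∧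
      logArg c d ε δ ≤ complexity c d ε δ ∧ complexity c d ε δ ≤ logArg c d ε δ ^ 3 := by
  have hmin := cMin_pos hk hc
  have hκ : 1 ≤ cMax c / cMin c := by
    rw [one_le_div hmin]
    exact (cMin_le c ⟨0, hk⟩).trans (le_cMax c _)
  have hε' : 1 ≤ 1 / ε := by rw [one_le_div hε]; exact hε1.le
  have hδ' : 1 ≤ 1 / δ := by rw [one_le_div hδ]; exact hδ1.le
  have hk' : (1 : ℝ) ≤ k := by exact_mod_cast hk
  have hd' : (1 : ℝ) ≤ d := by exact_mod_cast hd
  have hlog0 : 0 ≤ Real.log (1 / δ) := Real.log_nonneg hδ'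
  have hlog : Real.log (1 / δ) ≤ 1 / δ - 1 := Real.log_le_sub_one_of_pos (by positivity)
  have hL : logArg c d ε δ = cMax c / cMin c * (1 / ε) * (1 / δ) * k * d := by
    unfold logArg; field_simp
  have hΛ : complexity c d ε δ =
      cMax c / cMin c * (1 / ε) * (1 / δ) * k * (k * (d + Real.log (1 / δ))) := by
    unfold complexity; field_simp
  have hcd : cMax c * k * d / (cMin c * ε) = cMax c / cMin c * (1 / ε) * k * d := by field_simp
  rw [hcd]
  set κ := cMax c / cMin c
  set e := 1 / ε
  set f := 1 / δ
  have h1 : 1 ≤ κ * e := one_le_mul_of_one_le_of_one_le hκ hε'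
  have h2 : 1 ≤ κ * e * f := one_le_mul_of_one_le_of_one_le h1 hδ'
  have h3 : 1 ≤ κ * e * f * k := one_le_mul_of_one_le_of_one_le h2 hk'
  have hkL : (k : ℝ) ≤ κ * e * f * k * d :=
    (le_mul_of_one_le_left (by linarith) h2).trans (le_mul_of_one_le_right (by linarith) hd')
  have hdL : (d : ℝ) ≤ κ * e * f * k * d := le_mul_of_one_le_left (by linarith) h3
  have hfL : f ≤ κ * e * f * k * d :=
    (le_mul_of_one_le_left (by linarith) h1).trans
      ((le_mul_of_one_le_right (by linarith) hk').trans
        (le_mul_of_one_le_right (by linarith) hd'))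
  rw [hL, hΛ]
  refine ⟨hkL, hdL, hfL, ?_, ?_, ?_⟩
  · have : κ * e * f * k * d = κ * e * k * d * f := by ring
    rw [this]
    exact le_mul_of_one_le_right (by positivity) hδ'
  · refine mul_le_mul_of_nonneg_left ?_ (by linarith)
    nlinarith
  · have h4 : (d : ℝ) + Real.log f ≤ d * f := by nlinarith
    have h0 : 0 ≤ κ * e * f * k * d := by linarith
    calc κ * e * f * k * (k * (d + Real.log f)) ≤ κ * e * f * k * (k * (d * f)) := by gcongr
      _ = (κ * e * f * k * d) * k * f := by ring
      _ ≤ (κ * e * f * k * d) * (κ * e * f * k * d) * (κ * e * f * k * d) := by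
          gcongr
      _ = _ := by ring

/-- Bounds for the confidence parameters of a cover whose cardinality is about `Λ ^ (Q * d)`. -/
theorem scale_bounds {Λ : ℝ} (hΛ : 2 ≤ Λ) (hd : 1 ≤ d) (hδ : 0 < δ) (hδ1 : δ < 1)
    (hδΛ : 1 / δ ≤ Λ) (hN1 : Λ ^ (Q * d) ≤ (N : ℝ)) (hN2 : (N : ℝ) ≤ Λ ^ ((Q + 1) * d)) :
    0 < delta₁ d N δ ∧ 8 * delta₁ d N δ ≤ δ ∧
      Real.log (N / delta₁ d N δ) ≤ (2 * Q + 10) * d * Real.log Λ ∧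
      scale d N δ ≤ (Q + 6) * d * Real.log Λ ∧ 2 + Q * d * Real.log Λ ≤ scale d N δ := by
  have hd' : (1 : ℝ) ≤ d := by exact_mod_cast hd
  have hN0 : (1 : ℝ) ≤ N := (one_le_pow₀ (by linarith)).trans hN1
  have hℓ2 : Real.log 2 ≤ Real.log Λ := Real.log_le_log (by norm_num) hΛ
  have hlog2 := Real.log_two_gt_d9
  have hℓ : 0.69 ≤ Real.log Λ := by linarith
  have hlδ0 : 0 ≤ Real.log (1 / δ) := Real.log_nonneg (by rw [one_le_div hδ]; exact hδ1.le)
  have hlδ : Real.log (1 / δ) ≤ Real.log Λ := Real.log_le_log (by positivity) hδΛ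
  have hlN1 : Q * d * Real.log Λ ≤ Real.log N := by
    have := Real.log_le_log (by positivity) hN1
    rw [Real.log_pow] at this
    push_cast at this
    exact this
  have hlN2 : Real.log N ≤ (Q + 1) * d * Real.log Λ := by
    have := Real.log_le_log (by positivity) hN2
    rw [Real.log_pow] at this
    push_cast at this
    exact this
  have hlog4 : Real.log 4 = 2 * Real.log 2 := by
    rw [show (4 : ℝ) = 2 ^ 2 by norm_num, Real.log_pow]; norm_num
  have hlog8 : Real.log 8 = 3 * Real.log 2 := by
    rw [show (8 : ℝ) = 2 ^ 3 by norm_num, Real.log_pow]; norm_num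
  have hlN : Real.log (2 * N / δ) = Real.log 2 + Real.log N + Real.log (1 / δ) := by
    rw [div_eq_mul_one_div, Real.log_mul (by positivity) (by positivity),
      Real.log_mul (by norm_num) (by positivity)]
  have hlN0 : 0 ≤ Real.log N := Real.log_nonneg hN0
  set w := (d : ℝ) + Real.log (2 * N / δ) with hw
  have hw1 : 1 ≤ w := by rw [hw, hlN]; linarith
  have hδ₁ : delta₁ d N δ = δ / (8 * w) := rfl
  have hs : scale d N δ = d + Real.log 4 + Real.log N + Real.log (1 / δ) := by
    have : 1 / delta₂ N δ = 4 * N * (1 / δ) := by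
      unfold delta₂; field_simp
    rw [scale, this, Real.log_mul (by positivity) (by positivity),
      Real.log_mul (by norm_num) (by positivity)]
    ring
  have hdℓ : 0.69 * (d : ℝ) ≤ d * Real.log Λ := by
    rw [mul_comm]; gcongr
  have hℓd : Real.log Λ ≤ d * Real.log Λ := le_mul_of_one_le_left (by linarith) hd'
  have e1 : ((Q : ℝ) + 1) * d * Real.log Λ = (Q + 1) * (d * Real.log Λ) := by ring
  have e2 : (2 * (Q : ℝ) + 10) * d * Real.log Λ =
    2 * ((Q + 1) * (d * Real.log Λ)) + 8 * (d * Real.log Λ) := by ring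
  have e3 : ((Q : ℝ) + 6) * d * Real.log Λ =
    (Q + 1) * (d * Real.log Λ) + 5 * (d * Real.log Λ) := by ring
  rw [e1] at hlN2
  refine ⟨?_, ?_, ?_, ?_, ?_⟩
  · rw [hδ₁]; positivity
  · rw [hδ₁, show 8 * (δ / (8 * w)) = δ / w by field_simp]
    exact div_le_self hδ.le hw1
  · have h1 : N / delta₁ d N δ = 8 * w * N * (1 / δ) := by
      rw [hδ₁]; field_simp
    rw [h1, Real.log_mul (by positivity) (by positivity),
      Real.log_mul (by positivity) (by positivity), Real.log_mul (by norm_num) (by positivity), e2]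
    have h2 : Real.log w ≤ w - 1 := Real.log_le_sub_one_of_pos (by linarith)
    have h3 : w = d + (Real.log 2 + Real.log N + Real.log (1 / δ)) := by rw [hw, hlN]
    linarith
  · rw [hs, e3]
    linarith
  · rw [hs]
    linarith

theorem linear_le_two_pow {p : ℕ} (hp : 40 ≤ p) : (32 * (80 * p + 14) : ℝ) ≤ 2 ^ (p - 2) := by
  induction p, hp using Nat.le_induction with
  | base => norm_num
  | succ p hp ih =>
    have : p + 1 - 2 = (p - 2) + 1 := by omega
    rw [this, pow_succ]
    have : (40 : ℝ) ≤ p := by exact_mod_cast hp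
    push_cast
    linarith

/-- The number of labelings of the double sample is beaten by the factor `2 ^ q` gained from
symmetrization. -/
theorem labelings_le_two_pow {Λ s : ℝ} {p M : ℕ} (hp : 40 ≤ p) (hΛ : 2 ≤ Λ) (hd : 1 ≤ d)
    (hdΛ : (d : ℝ) ≤ Λ) (hδ : 0 < δ) (hδΛ : 1 / δ ≤ Λ) (hs : s ≤ (40 * p + 6) * d * Real.log Λ)
    (hs' : 2 + 40 * p * d * Real.log Λ ≤ s) (hM : 32 * (M : ℝ) ≤ Λ ^ p) :
    2 * (((2 * ⌊s / 2⌋₊ + 2 * ⌊s / 2⌋₊) * M + 1 : ℕ) : ℝ) ^ d ≤ δ * 2 ^ ⌊s / 2⌋₊ := by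
  set q := ⌊s / 2⌋₊
  have hd' : (1 : ℝ) ≤ d := by exact_mod_cast hd
  have hp' : (40 : ℝ) ≤ p := by exact_mod_cast hp
  have hΛ1 : 1 ≤ Λ := by linarith
  have hlog2 := Real.log_two_gt_d9
  have hℓ2 : Real.log 2 ≤ Real.log Λ := Real.log_le_log (by norm_num) hΛ
  have hℓΛ : Real.log Λ ≤ Λ := (Real.log_le_sub_one_of_pos (by linarith)).trans (by linarith)
  have hℓ0 : 0 ≤ Real.log Λ := by linarith
  have hs0 : 0 ≤ s := by
    have : 0 ≤ 40 * p * d * Real.log Λ := by positivity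
    linarith
  have hq1 : (q : ℝ) ≤ s / 2 := Nat.floor_le (by linarith)
  have hq2 : s / 2 < q + 1 := Nat.lt_floor_add_one _
  have hdl : (d : ℝ) * Real.log Λ ≤ Λ ^ 2 := by
    rw [pow_two]; exact mul_le_mul hdΛ hℓΛ hℓ0 (by linarith)
  have hpow : (80 * p + 14 : ℝ) * 32 ≤ Λ ^ (p - 2) :=
    le_trans (by linarith [linear_le_two_pow hp]) (pow_le_pow_left₀ (by norm_num) hΛ (p - 2))
  have hbase : (((2 * q + 2 * q) * M + 1 : ℕ) : ℝ) ≤ Λ ^ (2 * p + 1) := by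
    push_cast
    have h1 : (q : ℝ) ≤ (80 * p + 14) * Λ ^ 2 := by
      have : (40 * p + 6 : ℝ) * d * Real.log Λ ≤ (80 * p + 14) * Λ ^ 2 := by
        rw [mul_assoc]
        exact mul_le_mul (by linarith) hdl (by positivity) (by positivity)
      linarith
    have h2 : (q : ℝ) * 32 ≤ Λ ^ p := by
      calc (q : ℝ) * 32 ≤ (80 * p + 14) * 32 * Λ ^ 2 := by linarith
        _ ≤ Λ ^ (p - 2) * Λ ^ 2 := by gcongr
        _ = Λ ^ p := by rw [← pow_add]; congr 1; omega
    have h3 : ((q : ℝ) * 32) * (32 * (M : ℝ)) ≤ Λ ^ p * Λ ^ p :=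
      mul_le_mul h2 hM (by positivity) (by positivity)
    have h4 : (1 : ℝ) ≤ Λ ^ p * Λ ^ p := one_le_mul_of_one_le_of_one_le (one_le_pow₀ hΛ1)
      (one_le_pow₀ hΛ1)
    have h5 : Λ ^ (2 * p + 1) = Λ ^ p * Λ ^ p * Λ := by rw [← pow_add, ← two_mul, pow_succ]
    have h6 : Λ ^ p * Λ ^ p * 2 ≤ Λ ^ p * Λ ^ p * Λ := by gcongr
    rw [h5]
    have h7 : (2 * (q : ℝ) + 2 * q) * M = ((q : ℝ) * 32) * (32 * (M : ℝ)) / 256 := by ring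
    rw [h7]
    linarith
  -- `q ≥ 20 p d log Λ` exceeds the base-two logarithm of the left side
  have hexp : Λ ^ (1 + (2 * p + 1) * d + 1) ≤ (2 : ℝ) ^ q := by
    rw [← Real.log_le_log_iff (by positivity) (by positivity), Real.log_pow, Real.log_pow]
    push_cast
    have h1 : 20 * p * d * Real.log Λ ≤ q := by linarith
    have h2 : (1 + (2 * (p : ℝ) + 1) * d + 1) ≤ 10 * p * d := by nlinarith
    calc (1 + (2 * (p : ℝ) + 1) * d + 1) * Real.log Λ ≤ 10 * p * d * Real.log Λ := by gcongr
      _ = (20 * p * d * Real.log Λ) * (1 / 2) := by ring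
      _ ≤ q * Real.log 2 := by gcongr; linarith
  calc 2 * (((2 * q + 2 * q) * M + 1 : ℕ) : ℝ) ^ d
      ≤ Λ * (Λ ^ (2 * p + 1)) ^ d := by gcongr
    _ = δ * ((1 / δ) * (Λ * Λ ^ ((2 * p + 1) * d))) := by
        rw [← pow_mul]; field_simp
    _ ≤ δ * (Λ * (Λ * Λ ^ ((2 * p + 1) * d))) := by gcongr
    _ = δ * Λ ^ (1 + (2 * p + 1) * d + 1) := by ring
    _ ≤ δ * 2 ^ q := by gcongr

end Parameters

/-! ### Infinite classes -/

section InfiniteClasses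

variable {k : ℕ} {c : Fin k → ℝ}

theorem sum_roundUp_le (hk : 0 < k) (hc : ∀ i, 0 < c i) {m : Fin k → ℝ} (hm : ∀ i, 0 ≤ m i)
    {M : ℝ} (hM : 0 ≤ M) (h : cost c m ≤ cost c (fun _ => M)) :
    ((∑ i, roundUp m i : ℕ) : ℝ) ≤ cMax c * k / cMin c * (M + 1) := by
  have hmin := cMin_pos hk hc
  have hκ : cMin c ≤ cMax c := (cMin_le c ⟨0, hk⟩).trans (le_cMax c _)
  have h1 : cMin c * ∑ i, m i ≤ cost c m := by
    rw [cost, Finset.mul_sum]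
    exact Finset.sum_le_sum fun i _ => mul_le_mul_of_nonneg_right (cMin_le c i) (hm i)
  have h2 : cost c (fun _ => M) ≤ cMax c * k * M := by
    calc cost c (fun _ => M) ≤ ∑ _i : Fin k, cMax c * M :=
          Finset.sum_le_sum fun i _ => mul_le_mul_of_nonneg_right (le_cMax c i) hM
      _ = cMax c * k * M := by simp; ring
  have h3 : ((∑ i, roundUp m i : ℕ) : ℝ) ≤ ∑ i, m i + k := by
    push_cast
    calc ∑ i, (roundUp m i : ℝ) ≤ ∑ i, (m i + 1) :=
          Finset.sum_le_sum fun i _ => (Nat.ceil_lt_add_one (hm i)).le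
      _ = _ := by simp [Finset.sum_add_distrib]
  rw [div_mul_eq_mul_div, le_div_iff₀ hmin]
  have h4 : cMin c * k ≤ cMax c * k := by gcongr
  have h5 := mul_le_mul_of_nonneg_right h3 hmin.le
  linarith

/-- Rounding up a multiple `s ≥ 1` of an integral vector costs a factor of at most two, because
vanishing contributions are not affected. -/
theorem cost_roundUp_smul_natCast_le (hc : ∀ i, 0 < c i) {s : ℝ} (hs : 1 ≤ s) (m : Fin k → ℕ) :
    cost c (fun i => (roundUp (fun j => s * (m j : ℝ)) i : ℝ)) ≤
      2 * s * cost c (fun i => (m i : ℝ)) := by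
  rw [← cost_smul]
  refine cost_mono hc fun i => ?_
  simp only [roundUp]
  rcases Nat.eq_zero_or_pos (m i) with h0 | hpos
  · simp [h0]
  · have h1 : (1 : ℝ) ≤ m i := by exact_mod_cast hpos
    have := (Nat.ceil_lt_add_one (a := s * (m i : ℝ)) (by positivity)).le
    nlinarith

theorem cost_roundUp_smul_roundUp_le (hc : ∀ i, 0 < c i) {s : ℝ} (hs : 1 ≤ s) {m : Fin k → ℝ}
    (hm : ∀ i, 0 ≤ m i) :
    cost c (fun i => (roundUp (fun j => s * (roundUp m j : ℝ)) i : ℝ)) ≤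
      s * cost c m + 2 * s * ∑ i, c i := by
  have h1 := cost_roundUp_le (m := fun j => s * (roundUp m j : ℝ)) hc (fun i => by positivity)
  rw [cost_smul] at h1
  have h2 := mul_le_mul_of_nonneg_left (cost_roundUp_le hc hm) (by linarith : 0 ≤ s)
  have h3 : ∑ i, c i ≤ s * ∑ i, c i :=
    le_mul_of_one_le_left (Finset.sum_nonneg fun i _ => (hc i).le) hs
  linarith

variable {X : Type*} [MeasurableSpace X] {D : Fin k → Measure X} [∀ i, IsProbabilityMeasure (D i)]
  {H T : Set (X → Bool)} {d : ℕ} {ε δ : ℝ}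

/-- A solution of the program for a finite subclass which approximates all far apart pairs yields,
after repetition, a vector feasible for the whole class. -/
theorem pacFeasible_of_pair_cover (hH : Admissible H) (hd : vcDim H ≤ d) (hδ : 0 ≤ δ) (hT : T ⊆ H)
    {ρ η : ℝ}
    (hpair : ∀ h₁ ∈ H, ∀ h₂ ∈ H, FarApart D ε h₁ h₂ → ∃ g₁ ∈ T, ∃ g₂ ∈ T, FarApart D ε g₁ g₂ ∧
        (∀ i, D i (dis h₁ g₁) ≤ ENNReal.ofReal (2 * ρ)) ∧
        (∀ i, D i (dis h₂ g₂) ≤ ENNReal.ofReal (2 * ρ)))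
    {m n : Fin k → ℕ} (hη : η / (T.ncard : ℝ) ≤ 1 / 8)
    (hm : LPFeasible T D ε η (fun i => (m i : ℝ)))
    (hsum : ((∑ i, m i : ℕ) : ℝ) * (4 * ρ) ≤ 1 / 8) {q : ℕ} (hmn : ∀ i, 2 * q * m i ≤ n i)
    (hcount : 2 * (((2 * q + 2 * q) * ∑ i, m i + 1 : ℕ) : ℝ) ^ d ≤ δ * 2 ^ q) :
    PACFeasible H D ε δ n := by
  refine pacFeasible_of_blocks hH hd hδ hmn (fun h₁ hh₁ h₂ hh₂ hfar => ?_) hcount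
  obtain ⟨g₁, hg₁, g₂, hg₂, hgfar, hc₁, hc₂⟩ := hpair h₁ hh₁ h₂ hh₂ hfar
  have hmeas := hH.measurableSet_dis
  refine (prod_avoid_le_of_close (hmeas _ hh₁ _ hh₂) (hmeas _ (hT hg₁) _ (hT hg₂))
    (hmeas _ hh₁ _ (hT hg₁)) (hmeas _ hh₂ _ (hT hg₂)) hc₁ hc₂ m).trans ?_
  have h1 := lpFeasible_natCast_iff.1 hm g₁ hg₁ g₂ hg₂ hgfar
  have h2 : ((∑ i, m i : ℕ) : ENNReal) * (2 * ENNReal.ofReal (2 * ρ)) ≤ ENNReal.ofReal (1 / 8) := by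
    rw [← ENNReal.ofReal_natCast, show (2 : ENNReal) = ENNReal.ofReal 2 by simp,
      ← ENNReal.ofReal_mul (by norm_num), ← ENNReal.ofReal_mul (Nat.cast_nonneg _)]
    refine ENNReal.ofReal_le_ofReal (le_trans (le_of_eq ?_) hsum)
    ring
  refine (add_le_add (h1.trans (ENNReal.ofReal_le_ofReal hη)) h2).trans (le_of_eq ?_)
  rw [← ENNReal.ofReal_add (by norm_num) (by norm_num),
    show (1 : ℝ) / 8 + 1 / 8 = 1 / 4 by norm_num, ENNReal.ofReal_div_of_pos (by norm_num)]
  simp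

/-- The cover of prescribed size. It extends a given small set, is much finer than the radius
demands, approximates the far apart pairs, and is padded to about `Λ ^ (40 * p * d)` elements, so
that the scaling factor is large enough for symmetrization. -/
theorem exists_padded_cover (hk : 0 < k) (hc : ∀ i, 0 < c i) (hd1 : 1 ≤ d) (hε : 0 < ε)
    (hε1 : ε < 1) (hδ : 0 < δ) (hδ1 : δ < 1) (hL : 2 ≤ logArg c d ε δ) (hinf : H.Infinite)
    (hmeas : ∀ h₁ ∈ H, ∀ h₂ ∈ H, MeasurableSet (dis h₁ h₂)) (hd : vcDim H ≤ d)
    {a : ℝ} (ha : 0 < a) {p : ℕ} (hp : 40 ≤ p) (hap : 1 / a ≤ 2 ^ (p - 1))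
    {H₀ : Set (X → Bool)} (hH₀ : H₀ ⊆ H) (hH₀fin : H₀.Finite)
    (hcard : (H₀.ncard : ℝ) ≤ (41 * (k : ℝ) / radius a c d ε δ) ^ d) :
    ∃ T : Set (X → Bool), H₀ ⊆ T ∧ IsCover H D (radius a c d ε δ) T ∧ T.Finite ∧
      complexity c d ε δ ^ (40 * p * d) ≤ (T.ncard : ℝ) ∧
      (T.ncard : ℝ) ≤ complexity c d ε δ ^ ((40 * p + 1) * d) ∧
      ∀ h₁ ∈ H, ∀ h₂ ∈ H, FarApart D ε h₁ h₂ → ∃ g₁ ∈ T, ∃ g₂ ∈ T, FarApart D ε g₁ g₂ ∧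
        (∀ i, D i (dis h₁ g₁) ≤ ENNReal.ofReal (2 * (complexity c d ε δ ^ p)⁻¹)) ∧
        (∀ i, D i (dis h₂ g₂) ≤ ENNReal.ofReal (2 * (complexity c d ε δ ^ p)⁻¹)) := by
  obtain ⟨hkL, hdL, -, -, hLΛ, -⟩ := parameter_bounds hk hc hd1 hε hε1 hδ hδ1
  rw [radius_eq a hk] at hcard ⊢
  set Λ := complexity c d ε δ
  have hΛ : 2 ≤ Λ := hL.trans hLΛ
  have hΛ1 : 1 ≤ Λ := by linarith
  have hk' : (1 : ℝ) ≤ k := by exact_mod_cast hk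
  have hd' : (1 : ℝ) ≤ d := by exact_mod_cast hd1
  have haΛ : 1 / a ≤ Λ ^ (p - 1) := hap.trans (pow_le_pow_left₀ (by norm_num) hΛ _)
  have hΛp : Λ ^ p = Λ ^ (p - 1) * Λ := by rw [← pow_succ]; congr 1; omega
  have hρ : 0 < (Λ ^ p)⁻¹ := by positivity
  obtain ⟨T₀, hT₀fin, hT₀cov, hT₀card, hpair⟩ := exists_finite_pair_cover (D := D) hmeas hd hd1
    (by omega) hρ (inv_le_one_of_one_le₀ (one_le_pow₀ hΛ1)) ε
  have hργ : (Λ ^ p)⁻¹ ≤ a * k / Λ := by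
    rw [hΛp, mul_inv, ← div_eq_mul_inv]
    refine div_le_div_of_nonneg_right ?_ (by linarith)
    calc (Λ ^ (p - 1))⁻¹ ≤ (1 / a)⁻¹ := inv_anti₀ (by positivity) haΛ
      _ = a * 1 := by simp
      _ ≤ a * k := by gcongr
  have hT₀card' : (T₀.ncard : ℝ) ≤ Λ ^ ((4 * p + 22) * d) := by
    refine hT₀card.trans ?_
    rw [div_inv_eq_mul]
    have h6 : (6 * k * d * Λ ^ p : ℝ) ≤ Λ ^ (p + 5) := by
      calc (6 * k * d * Λ ^ p : ℝ) ≤ 2 ^ 3 * Λ * Λ * Λ ^ p := by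
            gcongr
            · norm_num
            · linarith
            · linarith
        _ ≤ Λ ^ 3 * Λ * Λ * Λ ^ p := by gcongr
        _ = Λ ^ (p + 5) := by ring
    have h3 : (3 : ℝ) ≤ Λ ^ (2 * d) := by
      calc (3 : ℝ) ≤ 2 ^ 2 := by norm_num
        _ ≤ Λ ^ 2 := by gcongr
        _ ≤ Λ ^ (2 * d) := pow_le_pow_right₀ hΛ1 (by omega)
    calc 3 * (6 * k * d * Λ ^ p : ℝ) ^ (4 * d) ≤ Λ ^ (2 * d) * (Λ ^ (p + 5)) ^ (4 * d) := by gcongr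
      _ = Λ ^ ((4 * p + 22) * d) := by rw [← pow_mul, ← pow_add]; congr 1; ring
  have hH₀card' : (H₀.ncard : ℝ) ≤ Λ ^ ((4 * p + 22) * d) := by
    have h1 : 41 * (k : ℝ) / (a * k / Λ) = 41 * (1 / a) * Λ := by field_simp
    rw [h1] at hcard
    have h2 : 41 * (1 / a) * Λ ≤ Λ ^ (p + 6) := by
      calc 41 * (1 / a) * Λ ≤ 2 ^ 6 * Λ ^ (p - 1) * Λ := by gcongr; norm_num
        _ ≤ Λ ^ 6 * Λ ^ (p - 1) * Λ := by gcongr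
        _ = Λ ^ (p + 6) := by rw [← pow_add, ← pow_succ]; congr 1; omega
    calc (H₀.ncard : ℝ) ≤ (Λ ^ (p + 6)) ^ d :=
          hcard.trans (pow_le_pow_left₀ (by positivity) h2 d)
      _ = Λ ^ ((p + 6) * d) := by rw [← pow_mul]
      _ ≤ _ := pow_le_pow_right₀ hΛ1 (Nat.mul_le_mul_right _ (by omega))
  have hunion : ((H₀ ∪ T₀).ncard : ℝ) ≤ Λ ^ (40 * p * d) := by
    calc ((H₀ ∪ T₀).ncard : ℝ) ≤ (H₀.ncard : ℝ) + T₀.ncard := by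
          exact_mod_cast Set.ncard_union_le _ _
      _ ≤ 2 * Λ ^ ((4 * p + 22) * d) := by linarith
      _ ≤ Λ * Λ ^ ((4 * p + 22) * d) := by gcongr
      _ = Λ ^ ((4 * p + 22) * d + 1) := by rw [pow_succ, mul_comm]
      _ ≤ Λ ^ (40 * p * d) := pow_le_pow_right₀ hΛ1 (by nlinarith)
  obtain ⟨T, hsub, hTH, hTcard⟩ := hinf.exists_superset_ncard_eq
    (Set.union_subset hH₀ hT₀cov.1) (hH₀fin.union hT₀fin) (k := ⌈Λ ^ (40 * p * d)⌉₊)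
    (by exact_mod_cast hunion.trans (Nat.le_ceil _))
  have hpos : 0 < Λ ^ (40 * p * d) := by positivity
  have hone : 1 ≤ Λ ^ (40 * p * d) := one_le_pow₀ hΛ1
  refine ⟨T, Set.subset_union_left.trans hsub, ⟨hTH, fun h hh => ?_⟩, ?_, ?_, ?_, ?_⟩
  · obtain ⟨h', hh', hclose⟩ := hT₀cov.2 h hh
    exact ⟨h', hsub (Or.inr hh'), fun i => (hclose i).trans (ENNReal.ofReal_le_ofReal hργ)⟩
  · refine Set.finite_of_ncard_pos ?_
    rw [hTcard]
    exact Nat.ceil_pos.2 hpos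
  · rw [hTcard]; exact Nat.le_ceil _
  · rw [hTcard]
    calc (⌈Λ ^ (40 * p * d)⌉₊ : ℝ) ≤ Λ ^ (40 * p * d) + 1 := (Nat.ceil_lt_add_one hpos.le).le
      _ ≤ 2 * Λ ^ (40 * p * d) := by linarith
      _ ≤ Λ * Λ ^ (40 * p * d) := by gcongr
      _ = Λ ^ (40 * p * d + 1) := by rw [pow_succ, mul_comm]
      _ ≤ _ := pow_le_pow_right₀ hΛ1 (by nlinarith)
  · intro h₁ hh₁ h₂ hh₂ hfar
    obtain ⟨g₁, hg₁, g₂, hg₂, h⟩ := hpair h₁ hh₁ h₂ hh₂ hfar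
    exact ⟨g₁, hsub (Or.inr hg₁), g₂, hsub (Or.inr hg₂), h⟩

/-- After rounding up, an optimal solution has at most `Λ ^ p / 32` samples, by comparison
with equal contributions. -/
theorem sum_roundUp_optimal_le (hk : 0 < k) (hc : ∀ i, 0 < c i) (hd1 : 1 ≤ d) (hε : 0 < ε)
    (hε1 : ε < 1) {Λ x : ℝ} (hΛ : 2 ≤ Λ) (hκ : cMax c * k * d / (cMin c * ε) ≤ Λ) {p : ℕ}
    (hp : 40 ≤ p) (hx0 : 0 ≤ x) (hx : x ≤ (80 * p + 10) * d * Real.log Λ) {m : Fin k → ℝ}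
    (hm : ∀ i, 0 ≤ m i) (hopt : cost c m ≤ cost c (fun _ => (⌈x / ε⌉₊ : ℝ))) :
    32 * ((∑ i, roundUp m i : ℕ) : ℝ) ≤ Λ ^ p := by
  have hmin := cMin_pos hk hc
  have hmax : 0 < cMax c := (hc ⟨0, hk⟩).trans_le (le_cMax c _)
  have hd' : (1 : ℝ) ≤ d := by exact_mod_cast hd1
  have hlog2 := Real.log_two_gt_d9
  have hℓ2 : Real.log 2 ≤ Real.log Λ := Real.log_le_log (by norm_num) hΛ
  have hℓΛ : Real.log Λ ≤ Λ := (Real.log_le_sub_one_of_pos (by linarith)).trans (by linarith)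
  have hℓ0 : 0 ≤ Real.log Λ := by linarith
  have h1 : (⌈x / ε⌉₊ : ℝ) ≤ x / ε + 1 := (Nat.ceil_lt_add_one (by positivity)).le
  have h2 : (⌈x / ε⌉₊ : ℝ) + 1 ≤ d / ε * ((80 * p + 14) * Real.log Λ) := by
    have h3 : (1 : ℝ) ≤ d / ε := by rw [one_le_div hε]; linarith
    have h4 : x / ε ≤ d / ε * ((80 * p + 10) * Real.log Λ) := by
      calc x / ε ≤ (80 * p + 10) * d * Real.log Λ / ε := by gcongr
        _ = _ := by ring
    have h5 : d / ε * 2 ≤ d / ε * (4 * Real.log Λ) := by gcongr; linarith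
    have h6 : d / ε * ((80 * p + 14) * Real.log Λ) =
      d / ε * ((80 * p + 10) * Real.log Λ) + d / ε * (4 * Real.log Λ) := by ring
    linarith
  have h3 := sum_roundUp_le hk hc hm (Nat.cast_nonneg _) hopt
  calc 32 * ((∑ i, roundUp m i : ℕ) : ℝ)
      ≤ 32 * (cMax c * k / cMin c * (d / ε * ((80 * p + 14) * Real.log Λ))) := by
        gcongr
        exact h3.trans (by gcongr)
    _ = cMax c * k * d / (cMin c * ε) * (32 * (80 * p + 14)) * Real.log Λ := by
        field_simp
    _ ≤ Λ * 2 ^ (p - 2) * Λ := by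
        gcongr
        exact linear_le_two_pow hp
    _ ≤ Λ * Λ ^ (p - 2) * Λ := by gcongr
    _ = Λ ^ p := by
        rw [← pow_succ', ← pow_succ]; congr 1; omega

/-- Approximation by the programs for a suitable cover of an infinite class. The constants come from
`p`, which is determined by the constant `a` of the radius. -/
theorem infinite_classes {a : ℝ} (ha : 0 < a) {p : ℕ} (hp : 40 ≤ p) (hap : 1 / a ≤ 2 ^ (p - 1))
    (hk : 0 < k) (hinf : H.Infinite) (hH : Admissible H) (hd : vcDim H ≤ d) (hc : ∀ i, 0 < c i)
    (hε : 0 < ε) (hε1 : ε < 1) (hδ : 0 < δ) (hδ1 : δ < 1) (hL : 2 ≤ logArg c d ε δ)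
    {A : ℕ} (hA : 40 * p + 1 ≤ A) (haA : a ≤ A) {C : ℝ}
    (hC : C = 36 * (40 * p + 6) * (80 * p + 10))
    {H₀ : Set (X → Bool)} (hH₀ : H₀ ⊆ H) (hH₀fin : H₀.Finite)
    (hcard : (H₀.ncard : ℝ) ≤ (41 * (k : ℝ) / radius a c d ε δ) ^ d) :
    ∃ Hbar : Set (X → Bool),
      H₀ ⊆ Hbar ∧ IsCover H D (radius a c d ε δ) Hbar ∧ Hbar.Finite ∧
      (Hbar.ncard : ℝ) ≤ ((A : ℝ) * (k : ℝ) / radius a c d ε δ) ^ (A * d) ∧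
      (∃ m, IsIntLPSolution Hbar D c ε (delta₁ d Hbar.ncard δ) m) ∧
      (∀ m, IsIntLPSolution Hbar D c ε (delta₁ d Hbar.ncard δ) m →
        PACFeasible H D ε δ (roundUp fun i => scale d Hbar.ncard δ * (m i : ℝ)) ∧
        ∀ m' : Fin k → ℕ, PACFeasible H D ε δ m' →
          cost c (fun i => (roundUp (fun j => scale d Hbar.ncard δ * (m j : ℝ)) i : ℝ)) ≤
            C * infiniteFactor c d ε δ * cost c (fun i => (m' i : ℝ))) ∧
      (∀ m, IsLPSolution Hbar D c ε (delta₁ d Hbar.ncard δ) m →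
        PACFeasible H D ε δ (roundUp fun i => scale d Hbar.ncard δ * (roundUp m i : ℝ)) ∧
        ∀ m' : Fin k → ℕ, PACFeasible H D ε δ m' →
          scale d Hbar.ncard δ * cost c m ≤
            C * infiniteFactor c d ε δ * cost c (fun i => (m' i : ℝ)) ∧
          cost c (fun i => (roundUp (fun j => scale d Hbar.ncard δ * (roundUp m j : ℝ)) i : ℝ)) ≤
            C * infiniteFactor c d ε δ * cost c (fun i => (m' i : ℝ)) +
              2 * scale d Hbar.ncard δ * ∑ i, c i) := by
  have hd1 : 1 ≤ d := one_le_of_vcDim_le hd hinf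
  have hmeas := hH.measurableSet_dis
  obtain ⟨-, hdL, hδL, hκL, hLΛ, hΛL⟩ := parameter_bounds hk hc hd1 hε hε1 hδ hδ1
  obtain ⟨T, hH₀T, hcov, hTfin, hN1, hN2, hpair⟩ := exists_padded_cover (D := D) hk hc hd1 hε hε1
    hδ hδ1 hL hinf hmeas hd ha hp hap hH₀ hH₀fin hcard
  refine ⟨T, hH₀T, hcov, hTfin, ?_⟩
  rw [radius_eq a hk]
  set Λ := complexity c d ε δ
  have hΛ : 2 ≤ Λ := hL.trans hLΛ
  have hΛ1 : 1 ≤ Λ := by linarith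
  obtain ⟨hδ₁, hδ₁8, hlogN, hs, hs'⟩ := scale_bounds hΛ hd1 hδ hδ1 (hδL.trans hLΛ) hN1 hN2
  push_cast at hlogN hs hs'
  set δ₁ := delta₁ d T.ncard δ
  set s := scale d T.ncard δ
  have hℓ0 : 0 ≤ Real.log Λ := Real.log_nonneg hΛ1
  have hs1 : 2 ≤ s := by
    have : 0 ≤ 40 * (p : ℝ) * d * Real.log Λ := by positivity
    linarith
  have hN : (1 : ℝ) ≤ T.ncard := (one_le_pow₀ hΛ1).trans hN1
  have hNδ : 1 / δ ≤ T.ncard / δ₁ := div_le_div₀ (by linarith) hN hδ₁ (by linarith)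
  have hlδ : 0 < Real.log (1 / δ) := Real.log_pos (by rw [one_lt_div hδ]; exact hδ1)
  have hlog0 : Real.log (1 / δ) ≤ Real.log (T.ncard / δ₁) :=
    Real.log_le_log (by positivity) hNδ
  have hlogN' : Real.log (T.ncard / δ₁) ≤ (80 * p + 10) * d * Real.log Λ := by
    refine hlogN.trans (le_of_eq ?_); ring
  set r := Real.log (T.ncard / δ₁) / Real.log (1 / δ) with hr
  have hr1 : 1 ≤ r := by rw [hr, one_le_div hlδ]; exact hlog0
  have hpow : T.Nonempty → δ ^ r ≤ δ₁ / (T.ncard : ℝ) := fun _ => by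
    rw [hr, rpow_log_div_log hδ hδ1 (by positivity), one_div_div]
  -- Rounded-up solutions have few samples by optimality; `2 ⌊s / 2⌋` repetitions suffice.
  have hfeas : ∀ m : Fin k → ℝ, LPFeasible T D ε δ₁ m →
      cost c m ≤ cost c (fun _ => (⌈Real.log (T.ncard / δ₁) / ε⌉₊ : ℝ)) →
      PACFeasible H D ε δ (roundUp fun i => s * (roundUp m i : ℝ)) := by
    intro m hm hopt
    have hM := sum_roundUp_optimal_le hk hc hd1 hε hε1 hΛ (hκL.trans hLΛ) hp
      (hlδ.le.trans hlog0) hlogN' hm.1 hopt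
    refine pacFeasible_of_pair_cover (q := ⌊s / 2⌋₊) (m := roundUp m) hH hd hδ.le hcov.1
      hpair ?_ hm.roundUp ?_ (fun i => ?_)
      (labelings_le_two_pow hp hΛ hd1 (hdL.trans hLΛ) hδ (hδL.trans hLΛ) hs hs' hM)
    · exact (div_le_self hδ₁.le hN).trans (by linarith)
    · have hΛp : 0 < Λ ^ p := by positivity
      rw [← mul_assoc, ← div_eq_mul_inv, div_le_iff₀ hΛp]
      linarith
    · have h1 : (⌊s / 2⌋₊ : ℝ) ≤ s / 2 := Nat.floor_le (by linarith)
      have h2 : ((2 * ⌊s / 2⌋₊ * roundUp m i : ℕ) : ℝ) ≤ s * (roundUp m i : ℝ) := by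
        push_cast
        gcongr
        linarith
      exact_mod_cast h2.trans (Nat.le_ceil _)
  -- `s` and `log (|T| / δ₁)` are of order `d log Λ`, and `log Λ ≤ 3 log L`.
  have hfactor : ∀ x : ℝ, 0 ≤ x → 4 * (s * r) * x ≤ C * infiniteFactor c d ε δ * x := by
    intro x hx
    refine mul_le_mul_of_nonneg_right ?_ hx
    have hlogL : 0 ≤ Real.log (logArg c d ε δ) := Real.log_nonneg (by linarith)
    have hℓL : Real.log Λ ≤ 3 * Real.log (logArg c d ε δ) := by
      have := Real.log_le_log (by linarith) hΛL
      rw [Real.log_pow] at this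
      exact_mod_cast this
    rw [hC, infiniteFactor, hr, ← mul_div_assoc, ← mul_div_assoc, ← mul_div_assoc]
    refine div_le_div_of_nonneg_right ?_ hlδ.le
    calc 4 * (s * Real.log (T.ncard / δ₁))
        ≤ 4 * (((40 * p + 6) * d * Real.log Λ) * ((80 * p + 10) * d * Real.log Λ)) := by
          gcongr
          exact hlδ.le.trans hlog0
      _ ≤ 4 * (((40 * p + 6) * d * (3 * Real.log (logArg c d ε δ))) *
            ((80 * p + 10) * d * (3 * Real.log (logArg c d ε δ)))) := by gcongr
      _ = _ := by ring
  refine ⟨?_, exists_isIntLPSolution hTfin hc hε hδ₁, fun m hm => ⟨?_, fun m' hm' => ?_⟩,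
    fun m hm => ⟨?_, fun m' hm' => ?_⟩⟩
  · have h1 : Λ ≤ A * k / (a * k / Λ) := by
      have : (A : ℝ) * k / (a * k / Λ) = A / a * Λ := by field_simp
      rw [this]
      exact le_mul_of_one_le_left (by linarith) (by rw [one_le_div ha]; exact haA)
    calc (T.ncard : ℝ) ≤ Λ ^ ((40 * p + 1) * d) := hN2
      _ ≤ Λ ^ (A * d) := pow_le_pow_right₀ hΛ1 (Nat.mul_le_mul_right _ hA)
      _ ≤ _ := pow_le_pow_left₀ (by linarith) h1 _
  · have h := hfeas _ hm.1 (hm.2 (fun _ => ⌈Real.log (T.ncard / δ₁) / ε⌉₊)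
      (lpFeasible_const_ceil hTfin hε hδ₁))
    simpa [roundUp] using h
  · have h1 : cost c (fun i => (m i : ℝ)) ≤ ⌈r⌉₊ * cost c (fun i => (m' i : ℝ)) := by
      rw [← cost_smul]
      have h := hm.2 (fun i => ⌈r⌉₊ * m' i)
      simp only [Nat.cast_mul] at h
      refine h (hm'.lpFeasible_smul hδ.le hδ1.le (by positivity) hcov.1 hmeas fun hne => ?_)
      exact (Real.rpow_le_rpow_of_exponent_ge hδ hδ1.le (Nat.le_ceil _)).trans (hpow hne)
    have hx : 0 ≤ cost c (fun i => (m' i : ℝ)) := cost_nonneg hc fun i => Nat.cast_nonneg _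
    have h2 : (⌈r⌉₊ : ℝ) ≤ 2 * r := by
      have := (Nat.ceil_lt_add_one (by linarith : 0 ≤ r)).le
      linarith
    calc _ ≤ 2 * s * cost c (fun i => (m i : ℝ)) :=
          cost_roundUp_smul_natCast_le hc (by linarith) m
      _ ≤ 2 * s * (2 * r * cost c (fun i => (m' i : ℝ))) := by
          gcongr
          exact h1.trans (by gcongr)
      _ = 4 * (s * r) * cost c (fun i => (m' i : ℝ)) := by ring
      _ ≤ _ := hfactor _ hx
  · exact hfeas m hm.1 (hm.2 _ (lpFeasible_const_ceil hTfin hε hδ₁))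
  · have hx : 0 ≤ cost c (fun i => (m' i : ℝ)) := cost_nonneg hc fun i => Nat.cast_nonneg _
    have h1 : cost c m ≤ r * cost c (fun i => (m' i : ℝ)) := by
      rw [← cost_smul]
      exact hm.2 _ (hm'.lpFeasible_smul hδ.le hδ1.le (by linarith) hcov.1 hmeas hpow)
    have h2 : s * cost c m ≤ C * infiniteFactor c d ε δ * cost c (fun i => (m' i : ℝ)) := by
      refine le_trans ?_ (hfactor _ hx)
      have h3 : 0 ≤ s * r * cost c (fun i => (m' i : ℝ)) := by positivity
      calc s * cost c m ≤ s * (r * cost c (fun i => (m' i : ℝ))) := by gcongr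
        _ ≤ _ := by linarith
    exact ⟨h2, (cost_roundUp_smul_roundUp_le hc (by linarith) hm.1.1).trans (by linarith)⟩

end InfiniteClasses

end CollabPAC

theorem mainTheorem1 :
    -- finite classes
    (∀ (X Y : Type*) [MeasurableSpace X] (k : ℕ) (H : Set (X → Y)) (D : Fin k → Measure X)
        [∀ i, IsProbabilityMeasure (D i)] (c : Fin k → ℝ) (ε δ : ℝ),
      H.Finite → (∀ h₁ ∈ H, ∀ h₂ ∈ H, MeasurableSet (CollabPAC.dis h₁ h₂)) →
      (∀ i, 0 < c i) → 0 < ε → 0 < δ → δ < 1 →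
      -- the linear program, solved over the reals and rounded up
      ((∀ h₁ ∈ H, ∀ h₂ ∈ H, (∃ i, ENNReal.ofReal ε < D i (CollabPAC.dis h₁ h₂)) →
          ∀ i, D i (CollabPAC.dis h₁ h₂) ≠ 1) →
        ∃ m, CollabPAC.IsLPSolution H D c ε δ m) ∧
      (∀ m, CollabPAC.IsLPSolution H D c ε δ m →
        CollabPAC.PACFeasible H D ε δ (CollabPAC.roundUp m) ∧
        ∀ m' : Fin k → ℕ, CollabPAC.PACFeasible H D ε δ m' →
          CollabPAC.cost c m ≤
            CollabPAC.finiteFactor H.ncard δ * CollabPAC.cost c (fun i => (m' i : ℝ)) ∧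
          CollabPAC.cost c (fun i => (CollabPAC.roundUp m i : ℝ)) ≤
            CollabPAC.finiteFactor H.ncard δ * CollabPAC.cost c (fun i => (m' i : ℝ)) +
              ∑ i, c i) ∧
      -- the program solved over the natural numbers
      (∃ m, CollabPAC.IsIntLPSolution H D c ε δ m) ∧
      (∀ m, CollabPAC.IsIntLPSolution H D c ε δ m →
        CollabPAC.PACFeasible H D ε δ m ∧
        ∀ m' : Fin k → ℕ, CollabPAC.PACFeasible H D ε δ m' →
          CollabPAC.cost c (fun i => (m i : ℝ)) ≤
            (⌈CollabPAC.finiteFactor H.ncard δ⌉₊ : ℝ) *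
              CollabPAC.cost c (fun i => (m' i : ℝ)))) ∧
    -- infinite classes
    (∀ a : ℝ, 0 < a → ∃ (A : ℕ) (C : ℝ),
      ∀ (X : Type*) [MeasurableSpace X] (k : ℕ) (H : Set (X → Bool)) (D : Fin k → Measure X)
        [∀ i, IsProbabilityMeasure (D i)] (c : Fin k → ℝ) (d : ℕ) (ε δ : ℝ),
      0 < k → H.Infinite → CollabPAC.Admissible H → CollabPAC.vcDim H = (d : ℕ∞) →
      (∀ i, 0 < c i) → 0 < ε → ε < 1 → 0 < δ → δ < 1 → 2 ≤ CollabPAC.logArg c d ε δ →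
      ∀ H₀ ⊆ H, H₀.Finite →
        (H₀.ncard : ℝ) ≤ (41 * (k : ℝ) / CollabPAC.radius a c d ε δ) ^ d →
      ∃ Hbar : Set (X → Bool),
        H₀ ⊆ Hbar ∧ CollabPAC.IsCover H D (CollabPAC.radius a c d ε δ) Hbar ∧ Hbar.Finite ∧
        (Hbar.ncard : ℝ) ≤ ((A : ℝ) * (k : ℝ) / CollabPAC.radius a c d ε δ) ^ (A * d) ∧
        -- the program solved over the natural numbers
        (∃ m, CollabPAC.IsIntLPSolution Hbar D c ε (CollabPAC.delta₁ d Hbar.ncard δ) m) ∧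
        (∀ m, CollabPAC.IsIntLPSolution Hbar D c ε (CollabPAC.delta₁ d Hbar.ncard δ) m →
          CollabPAC.PACFeasible H D ε δ
            (CollabPAC.roundUp fun i => CollabPAC.scale d Hbar.ncard δ * (m i : ℝ)) ∧
          ∀ m' : Fin k → ℕ, CollabPAC.PACFeasible H D ε δ m' →
            CollabPAC.cost c (fun i => (CollabPAC.roundUp
                (fun j => CollabPAC.scale d Hbar.ncard δ * (m j : ℝ)) i : ℝ)) ≤
              C * CollabPAC.infiniteFactor c d ε δ *
                CollabPAC.cost c (fun i => (m' i : ℝ))) ∧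
        -- the linear program, solved over the reals and rounded up
        (∀ m, CollabPAC.IsLPSolution Hbar D c ε (CollabPAC.delta₁ d Hbar.ncard δ) m →
          CollabPAC.PACFeasible H D ε δ
            (CollabPAC.roundUp fun i =>
              CollabPAC.scale d Hbar.ncard δ * (CollabPAC.roundUp m i : ℝ)) ∧
          ∀ m' : Fin k → ℕ, CollabPAC.PACFeasible H D ε δ m' →
            CollabPAC.scale d Hbar.ncard δ * CollabPAC.cost c m ≤
              C * CollabPAC.infiniteFactor c d ε δ *
                CollabPAC.cost c (fun i => (m' i : ℝ)) ∧
            CollabPAC.cost c (fun i => (CollabPAC.roundUp (fun j =>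
                CollabPAC.scale d Hbar.ncard δ * (CollabPAC.roundUp m j : ℝ)) i : ℝ)) ≤
              C * CollabPAC.infiniteFactor c d ε δ *
                  CollabPAC.cost c (fun i => (m' i : ℝ)) +
                2 * CollabPAC.scale d Hbar.ncard δ * ∑ i, c i)) := by
  refine ⟨fun X Y _ k H D _ c ε δ hH hmeas hc hε hδ hδ1 =>
    CollabPAC.finite_classes hH hmeas hc hε hδ hδ1, fun a ha => ?_⟩
  -- The cover radius `Λ ^ (-p)`, with `p = 40 + n`, has to be smaller than `a * k / Λ`.
  obtain ⟨n, hn⟩ := pow_unbounded_of_one_lt (1 / a) (one_lt_two (α := ℝ))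
  refine ⟨40 * (40 + n) + 1 + ⌈a⌉₊,
    36 * (40 * (40 + n : ℕ) + 6) * (80 * (40 + n : ℕ) + 10), ?_⟩
  intro X _ k H D _ c d ε δ hk hinf hH hd hc hε hε1 hδ hδ1 hL H₀ hH₀ hH₀fin hcard
  refine CollabPAC.infinite_classes ha (p := 40 + n) (by omega) ?_ hk hinf hH hd.le hc hε hε1 hδ hδ1
    hL (by omega) ?_ rfl hH₀ hH₀fin hcard
  · exact hn.le.trans (pow_le_pow_right₀ one_le_two (by omega))
  · push_cast
    have h1 := Nat.le_ceil a
    have h2 : (0 : ℝ) ≤ n := Nat.cast_nonneg n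
    linarith
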